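/- Let $v_1,\dots,v_n\in\mathbb R^d$ with $\|v_i\|_2\le 1$ for all $i$, and let $M$ be the $d\times n$ matrix with columns $v_1,\dots,v_n$. **Gram–Schmidt walk.** Start with $X_1=0\in[-1,1]^n$. As long as $\mathcal A_t=\{i:\ |X_t(i)|<1\}$ is non-empty, let $p_t=\max\mathcal A_t$ (the pivot), and let $u_t$ be a minimiser of $\|Mu\|_2$ over all $u\in\mathbb R^n$ with $u(p_t)=1$ and $u(i)=0$ for $i\notin\mathcal A_t$; if the minimiser is not unique, $u_t$ is chosen by an arbitrary fixed rule depending on $X_t$. Let $\Delta=\{\delta\in\mathbb R:\ X_t+\delta u_t\in[-1,1]^n\}$, $\delta^+=|\max\Delta|$, $\delta^-=|\min\Delta|$, and put $X_{t+1}=X_t+\delta^+u_t$ with probability $\delta^- /(\delta^-+\delta^+)$ and $X_{t+1}=X_t-\delta^-u_t$ with probability $\delta^+/(\delta^-+\delta^+)$. At least one coordinate is frozen in each step, so the walk stops after $T\le n$ steps. **Orthogonal vectors.** For a run of the walk, let $\mathcal P$ be the set of its pivots and, for $p\in\mathcal P$, let $I_p=\{t\le T:\ p_t=p\}$. List all indices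 of $[n]$ as follows: a pivot $p$ is listed immediately before the first step in $I_p$; any other index is listed immediately after the step $t$ in which it is frozen (that is, $i\in\mathcal A_t\setminus\mathcal A_{t+1}$), and indices listed at the same moment are listed in decreasing order. Let $r_i$ be the component of $v_i$ orthogonal to the span of all $v_j$ with $j$ listed after $i$, and let $w_i=r_i/\|r_i\|_2$ if $r_i\ne0$ and $w_i=0$ if $r_i=0$. For $p\in\mathcal P$ the blocks of $p$ are $Q^p_*=\{p\}$ and $Q^p_t=(\mathcal A_t\setminus\mathcal A_{t+1})\setminus\{p\}$ for $t\in I_p$. For $y\in\mathbb R^d$ define $$Z_y=\sum_{p\in\mathcal P}\Big(\sum_{s\in\{*\}\cup I_p}\Big|\sum_{j\in Q^p_s}\langle w_j,v_p\rangle\langle w_j,y\rangle\Big|\Big)^2,\qquad \hat T=\sum_{p\in\mathcal P}\#\{s\in\{*\}\cup I_p:\ w_j\neq0\text{ for some }j\in Q^p_s\}.$$ $\hat T$ is called the number of nontrivial time steps. **Theorem.** In every run of the walk, $0\le Z_{e_i}\le1$ for every standard basis vector $e_i$ of $\mathbb R^d$, and $\hat T\le\min(d,n)$. Moreover, there are signs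 $X\in\{-1,1\}^n$ such that $$\Big\|\sum_{i=1}^n v_iX_i\Big\|_\infty\le 2\max\Big(1,\ \sqrt{2\,\mathbf E\max_{1\le i\le d}Z_{e_i}}\;\sqrt{\log\mathbf E\hat T}\Big),$$ where $\mathbf E$ is the expectation over the walk, $\sqrt{\log\mathbf E\hat T}$ is read as $0$ when $\mathbf E\hat T<1$, and the maximum over an empty set ($d=0$) is read as $0$. -/

import Mathlib

namespace GSW

open scoped Classical in
/-- The set of unfrozen coordinates of a fractional colouring `x ∈ [-1,1]^n`. -/
noncomputable def unfrozen {n : ℕ} (x : Fin n → ℝ) : Finset (Fin n) :=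
  Finset.univ.filter fun i => |x i| < 1

/-- `M y = ∑ i, y i • v i`, where `M` is the matrix with columns `v i`. -/
noncomputable def combo {n d : ℕ} (v : Fin n → EuclideanSpace ℝ (Fin d)) (y : Fin n → ℝ) :
    EuclideanSpace ℝ (Fin d) :=
  ∑ i, y i • v i

/-- The admissible directions at position `x`: those `y` that have value `1` at the pivot (the
largest unfrozen index) and vanish at all frozen coordinates. -/
def admissible {n : ℕ} (x : Fin n → ℝ) : Set (Fin n → ℝ) :=
  {y | (∀ p : Fin n, (unfrozen x).max = (p : WithBot (Fin n)) → y p = 1) ∧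
    ∀ i ∉ unfrozen x, y i = 0}

/-- `u` is a rule that selects, at every position `x` with an unfrozen coordinate, a minimiser
`u x` of `‖M y‖₂` over the admissible directions `y`. -/
def IsDirectionRule {n d : ℕ} (v : Fin n → EuclideanSpace ℝ (Fin d))
    (u : (Fin n → ℝ) → Fin n → ℝ) : Prop :=
  ∀ x, (unfrozen x).Nonempty →
    u x ∈ admissible x ∧ IsMinOn (fun y => ‖combo v y‖) (admissible x) (u x)

/-- The step sizes `δ` for which `x + δ y` stays in the cube `[-1,1]^n`. -/
def stepSet {n : ℕ} (x y : Fin n → ℝ) : Set ℝ :=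
  {δ | ∀ i, x i + δ * y i ∈ Set.Icc (-1 : ℝ) 1}

/-- `δ⁺`, the absolute value of the largest possible step size. -/
noncomputable def stepPos {n : ℕ} (x y : Fin n → ℝ) : ℝ := |sSup (stepSet x y)|

/-- `δ⁻`, the absolute value of the smallest (most negative) possible step size. -/
noncomputable def stepNeg {n : ℕ} (x y : Fin n → ℝ) : ℝ := |sInf (stepSet x y)|

open scoped Classical in
/-- One step of the walk from `x`, with outcome `b` of the coin: `true` means the step `δ⁺`,
`false` the step `-δ⁻`.  The walk rests once all coordinates are frozen. -/
noncomputable def next {n : ℕ} (u : (Fin n → ℝ) → Fin n → ℝ) (x : Fin n → ℝ) (b : Bool) :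
    Fin n → ℝ :=
  if (unfrozen x).Nonempty then
    if b = true then x + stepPos x (u x) • u x else x - stepNeg x (u x) • u x
  else x

open scoped Classical in
/-- The probability of the outcome `b` of the coin at position `x`.  Once all coordinates are
frozen the coin no longer influences the walk, and it is taken to be fair. -/
noncomputable def coinProb {n : ℕ} (u : (Fin n → ℝ) → Fin n → ℝ) (x : Fin n → ℝ) (b : Bool) :
    ℝ :=
  if (unfrozen x).Nonempty then
    if b = true then stepNeg x (u x) / (stepNeg x (u x) + stepPos x (u x))
    else stepPos x (u x) / (stepNeg x (u x) + stepPos x (u x))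
  else 1 / 2

/-- The position of the walk after `t` steps, as a function of the coins `ω`.  Every step freezes
a coordinate, so that `n` coins determine the whole walk and the walk ends after at most `n`
steps. -/
noncomputable def position {n : ℕ} (u : (Fin n → ℝ) → Fin n → ℝ) (ω : Fin n → Bool) :
    ℕ → Fin n → ℝ
  | 0 => 0
  | t + 1 => if h : t < n then next u (position u ω t) (ω ⟨t, h⟩) else position u ω t

/-- The probability of the sequence `ω` of coin outcomes. -/
noncomputable def prob {n : ℕ} (u : (Fin n → ℝ) → Fin n → ℝ) (ω : Fin n → Bool) : ℝ :=
  ∏ t : Fin n, coinProb u (position u ω t) (ω t)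

/-- The expectation of a random variable on the (finite) probability space of the walk. -/
noncomputable def expect {n : ℕ} (u : (Fin n → ℝ) → Fin n → ℝ) (f : (Fin n → Bool) → ℝ) : ℝ :=
  ∑ ω, prob u ω * f ω

/-- The set of unfrozen coordinates after `t` steps. -/
noncomputable def active {n : ℕ} (u : (Fin n → ℝ) → Fin n → ℝ) (ω : Fin n → Bool) (t : ℕ) :
    Finset (Fin n) :=
  unfrozen (position u ω t)

/-! In the following definitions `A t` is the set of coordinates that are unfrozen after `t` steps
of a run of the walk, so that step number `t` (counted from `0`) leads from `A t` to `A (t + 1)`. -/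

/-- `p` is the pivot of step `t`. -/
def PivotAt {n : ℕ} (A : ℕ → Finset (Fin n)) (p : Fin n) (t : ℕ) : Prop :=
  (A t).max = (p : WithBot (Fin n))

open scoped Classical in
/-- The set of all pivots of the run. -/
noncomputable def pivots {n : ℕ} (A : ℕ → Finset (Fin n)) : Finset (Fin n) :=
  Finset.univ.filter fun p => ∃ t, PivotAt A p t

open scoped Classical in
/-- The set of steps with pivot `p` (there are at most `n` steps). -/
noncomputable def pivotSteps {n : ℕ} (A : ℕ → Finset (Fin n)) (p : Fin n) : Finset ℕ :=
  (Finset.range n).filter fun t => PivotAt A p t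

/-- The coordinates other than `p` that are frozen in step `t`. -/
def frozenWith {n : ℕ} (A : ℕ → Finset (Fin n)) (p : Fin n) (t : ℕ) : Finset (Fin n) :=
  (A t \ A (t + 1)).erase p

open scoped Classical in
/-- The moment at which an index is listed: a pivot is listed when it becomes the pivot, just
before its first step `t` (moment `2 t`), every other index when it is frozen, just after that
step `t` (moment `2 t + 1`). -/
noncomputable def moment {n : ℕ} (A : ℕ → Finset (Fin n)) (i : Fin n) : ℕ :=
  if i ∈ pivots A then 2 * sInf {t | PivotAt A i t}
  else 2 * sInf {t | i ∈ A t \ A (t + 1)} + 1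

/-- The order in which the indices are listed (as `σ(n), σ(n-1), …, σ(1)`): `i` comes before `j`.
Indices that are listed at the same moment are listed in decreasing order. -/
def ListedBefore {n : ℕ} (A : ℕ → Finset (Fin n)) (i j : Fin n) : Prop :=
  moment A i < moment A j ∨ (moment A i = moment A j ∧ j < i)

/-- The component of `v i` orthogonal to all `v j` with `j` listed after `i`. -/
noncomputable def residual {n d : ℕ} (v : Fin n → EuclideanSpace ℝ (Fin d))
    (A : ℕ → Finset (Fin n)) (i : Fin n) : EuclideanSpace ℝ (Fin d) :=
  v i - (Submodule.span ℝ (v '' {j | ListedBefore A i j})).starProjection (v i)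

/-- The result `w i` of the Gram–Schmidt orthonormalisation of `v (σ 1), …, v (σ n)` at the
index `i`.  It is `0` if `v i` depends linearly on the vectors that precede it there. -/
noncomputable def gsVec {n d : ℕ} (v : Fin n → EuclideanSpace ℝ (Fin d))
    (A : ℕ → Finset (Fin n)) (i : Fin n) : EuclideanSpace ℝ (Fin d) :=
  ‖residual v A i‖⁻¹ • residual v A i

/-- `∑ j ∈ Q, ⟨w j, v p⟩ ⟨w j, y⟩`. -/
noncomputable def blockSum {n d : ℕ} (v : Fin n → EuclideanSpace ℝ (Fin d))
    (A : ℕ → Finset (Fin n)) (p : Fin n) (Q : Finset (Fin n)) (y : EuclideanSpace ℝ (Fin d)) : ℝ :=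
  ∑ j ∈ Q, inner ℝ (gsVec v A j) (v p) * inner ℝ (gsVec v A j) y

/-- The variance proxy `Z_y` of a run.  The blocks that belong to the pivot `p` are `{p}` and, for
every step with pivot `p`, the set of the other coordinates frozen in this step. -/
noncomputable def varProxy {n d : ℕ} (v : Fin n → EuclideanSpace ℝ (Fin d))
    (A : ℕ → Finset (Fin n)) (y : EuclideanSpace ℝ (Fin d)) : ℝ :=
  ∑ p ∈ pivots A,
    (|blockSum v A p {p} y| + ∑ t ∈ pivotSteps A p, |blockSum v A p (frozenWith A p t) y|) ^ 2

/-- A block is nontrivial if it contributes a new orthogonal vector. -/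
def Nontriv {n d : ℕ} (v : Fin n → EuclideanSpace ℝ (Fin d)) (A : ℕ → Finset (Fin n))
    (Q : Finset (Fin n)) : Prop :=
  ∃ j ∈ Q, gsVec v A j ≠ 0

open scoped Classical in
/-- The number `T̂` of nontrivial time steps of a run: the sum over all pivots `p` of the number of
nontrivial blocks of `p`. -/
noncomputable def nontrivSteps {n d : ℕ} (v : Fin n → EuclideanSpace ℝ (Fin d))
    (A : ℕ → Finset (Fin n)) : ℕ :=
  ∑ p ∈ pivots A,
    ((if Nontriv v A {p} then 1 else 0) +
      ((pivotSteps A p).filter fun t => Nontriv v A (frozenWith A p t)).card)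

end GSW

/-! The proof rests on a subgaussian estimate: E exp(⟨MX, y⟩ - Z_y/2) ≤ 1 for every y
(`expect_exp_le_one`).

Least squares makes the image of the direction equal to `pivotImage`, the component r of the pivot
vector v_p orthogonal to the other unfrozen vectors. While p stays the pivot, r changes only when
other coordinates freeze, and the listing order is arranged so that ⟨r, y⟩ starts as the block sum
of {p} and then grows by the block sums of the frozen sets (`blockSum_singleton`,
`blockSum_frozenWith`). So C = ⟨r, y⟩ is bounded by the absolute block sums of p accumulated so far,
its `weight` G.

If nothing but p froze any more, the rest of the phase of p would contribute C(ε - x), where ε is a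
sign with mean x = X_t(p). The supermartingale `potential` is therefore exp(⟨MX_t, y⟩ - ∑ G²/2)
times the moment generating function `signMgf` of that contribution. A change of C by c costs a
factor exp(((G + |c|)² - G²)/2) (`signMgf_add_le`), exactly what the growth of G² pays for. The
costs of one phase telescope to the square of its total, and these squares add up to Z_y.

The usual union bound over ±e_i would lose log d. Here e^(b-a) + e^(-b-a) ≥ 2 - 2a, so 2 - c²Z_i may
be subtracted from the two exponentials of each coordinate before summing. By the subgaussian
estimate this leaves at most 2 + c² E ∑ Z_i, and ∑ Z_i ≤ T̂ by a weighted Cauchy–Schwarz inequality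
(`sum_varProxy_single_le`). Jensen's inequality and a choice of c bound the expected discrepancy
when E T̂ ≥ 2 (`mul_expect_norm_le`, `le_two_mul_max_of_forall_le`). When E T̂ < 2, some run has at
most one nontrivial block, and a deterministic estimate gives discrepancy at most 2 (`norm_le_two`).
-/

namespace GSW

open Real

/-! ### Moment generating function of a biased sign -/

/-- The centred moment generating function `E exp (C (ε - x))` of a sign `ε` with mean `x`. -/
noncomputable def signMgf (x C : ℝ) : ℝ := exp (-(C * x)) * (cosh C + x * sinh C)

lemma sinh_le_mul_cosh {a : ℝ} (ha : 0 ≤ a) : sinh a ≤ a * cosh a := by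
  have hmono : MonotoneOn (fun t : ℝ => t * cosh t - sinh t) (Set.Ici 0) := by
    apply monotoneOn_of_deriv_nonneg (convex_Ici 0) (by fun_prop) (by fun_prop)
    intro t ht
    rw [interior_Ici] at ht
    have h : HasDerivAt (fun t : ℝ => t * cosh t - sinh t) (1 * cosh t + t * sinh t - cosh t) t :=
      ((hasDerivAt_id t).mul (hasDerivAt_cosh t)).sub (hasDerivAt_sinh t)
    rw [h.deriv]
    have : 0 ≤ t * sinh t := mul_nonneg ht.le (sinh_nonneg_iff.2 ht.le)
    linarith
  have := hmono Set.self_mem_Ici ha ha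
  simp only [zero_mul, sinh_zero, sub_zero] at this
  linarith

lemma cosh_add_mul_sinh_nonneg {x : ℝ} (hx : |x| ≤ 1) (C : ℝ) : 0 ≤ cosh C + x * sinh C := by
  obtain ⟨h1, h2⟩ := abs_le.1 hx
  rw [cosh_eq, sinh_eq]
  nlinarith [exp_pos C, exp_pos (-C)]

/-- Divided by cosh C + x sinh C, this bounds by C the shift of the mean of the sign under
exponential tilting by C. It also controls the logarithmic derivative in `signMgf_le`. -/
lemma one_sub_sq_mul_sinh_le {x C : ℝ} (hx : |x| ≤ 1) (hC : 0 ≤ C) :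
    (1 - x ^ 2) * sinh C ≤ C * (cosh C + x * sinh C) := by
  have hD := cosh_add_mul_sinh_nonneg hx C
  -- Half angles: after multiplication by cosh a and use of sinh a ≤ a cosh a, the remaining gap is
  -- 2 sinh a (sinh a + x cosh a)².
  obtain ⟨a, rfl⟩ : ∃ a, C = 2 * a := ⟨C / 2, by ring⟩
  have ha : 0 ≤ a := by linarith
  have hs : 0 ≤ sinh a := sinh_nonneg_iff.2 ha
  have hc := cosh_pos a
  have hle := sinh_le_mul_cosh ha
  have hsq := cosh_sq a
  rw [sinh_two_mul, cosh_two_mul] at *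
  refine le_of_mul_le_mul_right ?_ hc
  have h1 := mul_le_mul_of_nonneg_right hle hD
  have h2 : 0 ≤ sinh a * (sinh a + x * cosh a) ^ 2 := by positivity
  nlinarith

lemma signMgf_neg_neg (x C : ℝ) : signMgf (-x) (-C) = signMgf x C := by
  simp [signMgf]

lemma signMgf_le {x : ℝ} (hx : |x| ≤ 1) (C : ℝ) : signMgf x C ≤ exp (C ^ 2 / 2) := by
  wlog hC : 0 ≤ C generalizing x C
  · have := this (x := -x) (by simpa using hx) (-C) (by linarith)
    rwa [signMgf_neg_neg, neg_sq] at this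
  -- The quotient of the two sides has value 1 at t = 0, and its derivative has the sign of (1 - x²)
  -- sinh t - t (cosh t + x sinh t).
  have hanti : AntitoneOn
      (fun t : ℝ => exp (-(t * x) - t ^ 2 / 2) * (cosh t + x * sinh t)) (Set.Ici 0) := by
    apply antitoneOn_of_deriv_nonpos (convex_Ici 0) (by fun_prop) (by fun_prop)
    intro t ht
    rw [interior_Ici] at ht
    have h1 : HasDerivAt (fun t : ℝ => -(t * x) - t ^ 2 / 2) (-(1 * x) - (2 * t) / 2) t := by
      have h3 : HasDerivAt (fun t : ℝ => t ^ 2 / 2) (2 * t / 2) t := by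
        simpa using (hasDerivAt_pow 2 t).div_const 2
      exact (((hasDerivAt_id t).mul_const x).neg).sub h3
    have h2 : HasDerivAt (fun t : ℝ => cosh t + x * sinh t) (sinh t + x * cosh t) t :=
      (hasDerivAt_cosh t).add ((hasDerivAt_sinh t).const_mul x)
    have h3 : HasDerivAt (fun t : ℝ => exp (-(t * x) - t ^ 2 / 2) * (cosh t + x * sinh t))
        (exp (-(t * x) - t ^ 2 / 2) * (-(1 * x) - 2 * t / 2) * (cosh t + x * sinh t) +
          exp (-(t * x) - t ^ 2 / 2) * (sinh t + x * cosh t)) t := h1.exp.mul h2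
    rw [h3.deriv]
    have h := one_sub_sq_mul_sinh_le hx (Set.mem_Ioi.1 ht).le
    have he := exp_pos (-(t * x) - t ^ 2 / 2)
    have h4 := mul_le_mul_of_nonneg_left h he.le
    linarith
  have := hanti Set.self_mem_Ici hC hC
  simp only [zero_mul, sinh_zero, cosh_zero, mul_zero, add_zero] at this
  norm_num at this
  rw [sub_eq_add_neg, exp_add, exp_neg (C ^ 2 / 2)] at this
  have he := exp_pos (C ^ 2 / 2)
  rw [signMgf]
  calc exp (-(C * x)) * (cosh C + x * sinh C)
      = exp (-(C * x)) * (exp (C ^ 2 / 2))⁻¹ * (cosh C + x * sinh C) * exp (C ^ 2 / 2) := by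
        field_simp
    _ ≤ 1 * exp (C ^ 2 / 2) := by gcongr
    _ = _ := one_mul _

lemma signMgf_of_abs_eq_one {x : ℝ} (hx : |x| = 1) (C : ℝ) : signMgf x C = 1 := by
  rcases eq_or_eq_neg_of_abs_eq hx with rfl | rfl
  · simp [signMgf, cosh_add_sinh, ← exp_add]
  · have : cosh C + -1 * sinh C = exp (-C) := by rw [← cosh_sub_sinh]; ring
    rw [signMgf, this, ← exp_add]
    simp

lemma abs_one_sub_sq_mul_sinh_le {x : ℝ} (hx : |x| ≤ 1) (C : ℝ) :
    |(1 - x ^ 2) * sinh C| ≤ |C| * (cosh C + x * sinh C) := by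
  have hx2 : 0 ≤ 1 - x ^ 2 := by nlinarith [sq_abs x, abs_nonneg x]
  rw [abs_mul, abs_of_nonneg hx2, abs_sinh]
  rcases le_total 0 C with hC | hC
  · rw [abs_of_nonneg hC]
    exact one_sub_sq_mul_sinh_le hx hC
  · rw [abs_of_nonpos hC]
    have := one_sub_sq_mul_sinh_le (x := -x) (by simpa using hx) (neg_nonneg.2 hC)
    simpa using this

/-- Tilting the sign by C changes its mean from x to some q with |q - x| ≤ |C| ≤ G. The additional c
then costs exp(c(q - x)) for the recentring and exp(c²/2) for the tilted sign, and G|c| + c²/2 is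
the exponent claimed. -/
lemma signMgf_add_le {x C c G : ℝ} (hx : |x| ≤ 1) (hC : |C| ≤ G) :
    signMgf x (C + c) ≤ signMgf x C * exp (((G + |c|) ^ 2 - G ^ 2) / 2) := by
  have hexp : exp (C * c) ≤ exp (G * |c|) := exp_le_exp.2 <|
    (le_abs_self _).trans (by rw [abs_mul]; gcongr)
  rcases hx.lt_or_eq with hlt | heq
  · have hD : 0 < cosh C + x * sinh C := by
      obtain ⟨h1, h2⟩ := abs_lt.1 hlt
      rw [cosh_eq, sinh_eq]
      nlinarith [exp_pos C, exp_pos (-C)]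
    set D := cosh C + x * sinh C with hDdef
    -- the mean of the tilted sign
    set q := (sinh C + x * cosh C) / D with hq
    have hqD : q * D = sinh C + x * cosh C := div_mul_cancel₀ _ hD.ne'
    have hq1 : |q| ≤ 1 := by
      have : D ^ 2 - (q * D) ^ 2 = 1 - x ^ 2 := by
        rw [hqD, hDdef]; nlinarith [cosh_sq C]
      have hx2 : 0 ≤ 1 - x ^ 2 := by nlinarith [sq_abs x, abs_nonneg x]
      rw [← abs_one, ← sq_le_sq, one_pow]
      have h3 : q ^ 2 * D ^ 2 ≤ 1 * D ^ 2 := by nlinarith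
      exact le_of_mul_le_mul_right h3 (by positivity)
    have hqx : |q - x| ≤ |C| := by
      have h1 : (q - x) * D = (1 - x ^ 2) * sinh C := by
        rw [sub_mul, hqD, hDdef]; ring
      have h2 := abs_one_sub_sq_mul_sinh_le hx C
      rw [← h1, abs_mul, abs_of_pos hD] at h2
      exact le_of_mul_le_mul_right h2 hD
    have hsplit : signMgf x (C + c) = signMgf x C * (exp (c * (q - x)) * signMgf q c) := by
      have h1 : cosh (C + c) + x * sinh (C + c) = D * (cosh c + q * sinh c) := by
        have h3 : D * (cosh c + q * sinh c) = D * cosh c + q * D * sinh c := by ring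
        rw [h3, hqD, hDdef, cosh_add, sinh_add]; ring
      have h2 : exp (-((C + c) * x)) = exp (-(C * x)) * (exp (c * (q - x)) * exp (-(c * q))) := by
        rw [← exp_add, ← exp_add]; congr 1; ring
      rw [signMgf, h1, h2, signMgf, signMgf]; ring
    have hnn : 0 ≤ signMgf x C := mul_nonneg (exp_pos _).le hD.le
    rw [hsplit]
    refine mul_le_mul_of_nonneg_left ?_ hnn
    calc exp (c * (q - x)) * signMgf q c ≤ exp (G * |c|) * exp (c ^ 2 / 2) := by
          refine mul_le_mul ?_ (signMgf_le hq1 c)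
            (mul_nonneg (exp_pos _).le (cosh_add_mul_sinh_nonneg hq1 c)) (exp_pos _).le
          refine exp_le_exp.2 ((le_abs_self _).trans ?_)
          rw [abs_mul, mul_comm]
          exact mul_le_mul_of_nonneg_right (hqx.trans hC) (abs_nonneg c)
      _ = _ := by
          rw [← exp_add]; congr 1; rw [← sq_abs c]; ring
  · rw [signMgf_of_abs_eq_one heq, signMgf_of_abs_eq_one heq, one_mul]
    refine one_le_exp ?_
    have := (abs_nonneg C).trans hC
    nlinarith [abs_nonneg c, mul_nonneg this (abs_nonneg c)]

end GSW

/-! ### Gram–Schmidt orthonormalisation -/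

namespace GSW

section GramSchmidt

variable {E : Type*} [NormedAddCommGroup E] [InnerProductSpace ℝ E] [FiniteDimensional ℝ E]

/-- The normalised component of `a` orthogonal to `W` (`0` if `a ∈ W`). -/
noncomputable def unitComponent (W : Submodule ℝ E) (a : E) : E :=
  ‖a - W.starProjection a‖⁻¹ • (a - W.starProjection a)

lemma inner_unitComponent_of_mem (W : Submodule ℝ E) (a : E) {z : E} (hz : z ∈ W) :
    inner ℝ (unitComponent W a) z = 0 := by
  rw [unitComponent, real_inner_smul_left, Submodule.starProjection_inner_eq_zero a z hz, mul_zero]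

/-- Also valid for a ∈ W, where 0⁻¹ = 0 makes both sides vanish; no case distinction on linear
dependence is needed later. -/
lemma inner_unitComponent_smul (W : Submodule ℝ E) (a : E) :
    inner ℝ (unitComponent W a) a • unitComponent W a = a - W.starProjection a := by
  have h : inner ℝ (unitComponent W a) a = ‖a - W.starProjection a‖ := by
    have h1 : inner ℝ (unitComponent W a) a =
        inner ℝ (unitComponent W a) (a - W.starProjection a) := by
      rw [inner_sub_right, inner_unitComponent_of_mem W a (W.starProjection_apply_mem a), sub_zero]
    rw [h1, unitComponent, real_inner_smul_left, real_inner_self_eq_norm_mul_norm]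
    by_cases h0 : ‖a - W.starProjection a‖ = 0
    · simp [h0]
    · field_simp
  rw [h, unitComponent, smul_smul]
  by_cases h0 : ‖a - W.starProjection a‖ = 0
  · rw [norm_eq_zero.1 h0, smul_zero]
  · rw [mul_inv_cancel₀ h0, one_smul]

lemma unitComponent_mem {W V : Submodule ℝ E} (hWV : W ≤ V) {a : E} (ha : a ∈ V) :
    unitComponent W a ∈ V :=
  V.smul_mem _ (V.sub_mem ha (hWV (W.starProjection_apply_mem a)))

lemma norm_unitComponent {W : Submodule ℝ E} {a : E} (h : unitComponent W a ≠ 0) :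
    ‖unitComponent W a‖ = 1 := by
  have h0 : ‖a - W.starProjection a‖ ≠ 0 := by
    intro h0
    exact h (by rw [unitComponent, h0, inv_zero, zero_smul])
  rw [unitComponent, norm_smul, norm_inv, norm_norm, inv_mul_cancel₀ h0]

lemma starProjection_sup_span_singleton (W : Submodule ℝ E) (a x : E) :
    (W ⊔ Submodule.span ℝ {a}).starProjection x =
      W.starProjection x + inner ℝ (unitComponent W a) x • unitComponent W a := by
  set w := unitComponent W a with hw
  have hwa : inner ℝ w a • w = a - W.starProjection a := inner_unitComponent_smul W a
  have hW : ∀ z ∈ W, inner ℝ (x - (W.starProjection x + inner ℝ w x • w)) z = 0 := by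
    intro z hz
    rw [← sub_sub, inner_sub_left, Submodule.starProjection_inner_eq_zero x z hz,
      real_inner_smul_left, inner_unitComponent_of_mem W a hz, mul_zero, sub_zero]
  have hww : inner ℝ (x - (W.starProjection x + inner ℝ w x • w)) w = 0 := by
    have h1 : inner ℝ (W.starProjection x) w = 0 := by
      rw [real_inner_comm]
      exact inner_unitComponent_of_mem W a (W.starProjection_apply_mem x)
    rw [inner_sub_left, inner_add_left, h1, real_inner_smul_left, real_inner_comm w x, zero_add]
    by_cases h0 : w = 0
    · simp [h0]
    · rw [real_inner_self_eq_norm_mul_norm, norm_unitComponent h0]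
      ring
  refine Submodule.eq_starProjection_of_mem_of_inner_eq_zero ?_ ?_
  · refine Submodule.add_mem _ (Submodule.mem_sup_left (W.starProjection_apply_mem x))
      (Submodule.smul_mem _ _ (unitComponent_mem le_sup_left (Submodule.mem_sup_right ?_)))
    exact Submodule.mem_span_singleton_self a
  · intro z hz
    obtain ⟨z₁, hz₁, z₂, hz₂, rfl⟩ := Submodule.mem_sup.1 hz
    obtain ⟨c, rfl⟩ := Submodule.mem_span_singleton.1 hz₂
    have ha : a = W.starProjection a + inner ℝ w a • w := by rw [hwa]; abel
    rw [inner_add_right, hW z₁ hz₁, real_inner_smul_right, ha, inner_add_right,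
      hW _ (W.starProjection_apply_mem a), real_inner_smul_right, hww]
    simp

/-- Gram–Schmidt orthonormalisation of the vectors `v j`, `j ∈ Q`, over the span of `v '' U`. -/
lemma sum_inner_unitComponent_smul {ι : Type*} [LinearOrder ι] (v : ι → E) (U : Set ι)
    (Q : Finset ι) (x : E) :
    ∑ j ∈ Q, inner ℝ (unitComponent (Submodule.span ℝ (v '' (U ∪ {i | i ∈ Q ∧ i < j}))) (v j)) x •
        unitComponent (Submodule.span ℝ (v '' (U ∪ {i | i ∈ Q ∧ i < j}))) (v j) =
      (Submodule.span ℝ (v '' (U ∪ Q))).starProjection x -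
        (Submodule.span ℝ (v '' U)).starProjection x := by
  -- Adding a new largest index leaves the sets {i < j} of the old indices alone, so the sum
  -- telescopes.
  induction Q using Finset.induction_on_max with
  | empty => simp
  | insert a Q hlt ih =>
    have ha : a ∉ Q := fun h => lt_irrefl a (hlt a h)
    have h1 : {i | i ∈ insert a Q ∧ i < a} = (Q : Set ι) := by
      ext i
      simp only [Finset.mem_insert, Set.mem_ofPred_eq, SetLike.mem_coe]
      exact ⟨fun ⟨h, h'⟩ => h.resolve_left h'.ne, fun h => ⟨Or.inr h, hlt i h⟩⟩
    have h2 : ∀ j ∈ Q, {i | i ∈ insert a Q ∧ i < j} = {i | i ∈ Q ∧ i < j} := by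
      intro j hj
      ext i
      simp only [Finset.mem_insert, Set.mem_ofPred_eq]
      refine ⟨fun ⟨h, h'⟩ => ⟨h.resolve_left ?_, h'⟩, fun ⟨h, h'⟩ => ⟨Or.inr h, h'⟩⟩
      rintro rfl
      exact lt_asymm h' (hlt j hj)
    have h3 : v '' (U ∪ ↑(insert a Q)) = v '' (U ∪ ↑Q) ∪ {v a} := by
      rw [Finset.coe_insert, Set.union_insert, Set.image_insert_eq, Set.union_comm _ {v a},
        Set.singleton_union]
    rw [Finset.sum_insert ha, h1, Finset.sum_congr rfl fun j hj => by rw [h2 j hj], ih, h3,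
      Submodule.span_union, starProjection_sup_span_singleton]
    abel

end GramSchmidt

variable {n d : ℕ}

/-- The component of `v p` orthogonal to all `v i` with `i ∈ S`, `i ≠ p`. -/
noncomputable def pivotImage (v : Fin n → EuclideanSpace ℝ (Fin d)) (S : Finset (Fin n))
    (p : Fin n) : EuclideanSpace ℝ (Fin d) :=
  v p - (Submodule.span ℝ (v '' (S.erase p))).starProjection (v p)

lemma gsVec_eq_unitComponent (v : Fin n → EuclideanSpace ℝ (Fin d)) (A : ℕ → Finset (Fin n))
    (i : Fin n) :
    gsVec v A i = unitComponent (Submodule.span ℝ (v '' {j | ListedBefore A i j})) (v i) := rfl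

lemma ListedBefore.trans {A : ℕ → Finset (Fin n)} {i j k : Fin n} (hij : ListedBefore A i j)
    (hjk : ListedBefore A j k) : ListedBefore A i k := by
  unfold ListedBefore at *
  omega

lemma listedBefore_or_of_ne (A : ℕ → Finset (Fin n)) {i j : Fin n} (hij : i ≠ j) :
    ListedBefore A i j ∨ ListedBefore A j i := by
  unfold ListedBefore
  omega

lemma inner_gsVec_of_ne (v : Fin n → EuclideanSpace ℝ (Fin d)) (A : ℕ → Finset (Fin n))
    {i j : Fin n} (hij : i ≠ j) : inner ℝ (gsVec v A i) (gsVec v A j) = 0 := by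
  wlog h : ListedBefore A i j generalizing i j
  · rw [real_inner_comm]
    exact this hij.symm ((listedBefore_or_of_ne A hij).resolve_left h)
  refine inner_unitComponent_of_mem _ _ (unitComponent_mem ?_ ?_)
  · exact Submodule.span_mono (Set.image_mono fun k hk => h.trans hk)
  · exact Submodule.subset_span (Set.mem_image_of_mem v h)

lemma orthonormal_gsVec (v : Fin n → EuclideanSpace ℝ (Fin d)) (A : ℕ → Finset (Fin n)) :
    Orthonormal ℝ fun j : {j // gsVec v A j ≠ 0} => gsVec v A j :=
  ⟨fun j => norm_unitComponent j.2, fun _ _ hij =>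
    inner_gsVec_of_ne v A fun h => hij (Subtype.ext h)⟩

lemma sum_inner_gsVec_sq_le (v : Fin n → EuclideanSpace ℝ (Fin d)) (A : ℕ → Finset (Fin n))
    (y : EuclideanSpace ℝ (Fin d)) : ∑ j, inner ℝ (gsVec v A j) y ^ 2 ≤ ‖y‖ ^ 2 := by
  classical
  have h := (orthonormal_gsVec v A).sum_inner_products_le y (s := Finset.univ)
  refine le_trans (le_of_eq ?_) h
  simp only [Real.norm_eq_abs, sq_abs]
  rw [← Finset.sum_subtype (Finset.univ.filter fun j => gsVec v A j ≠ 0) (by simp)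
    fun j => inner ℝ (gsVec v A j) y ^ 2]
  refine (Finset.sum_filter_of_ne (p := fun j => gsVec v A j ≠ 0) fun j _ h0 hj => h0 ?_).symm
  simp [hj]

open scoped Classical in
lemma card_gsVec_ne_zero_le (v : Fin n → EuclideanSpace ℝ (Fin d)) (A : ℕ → Finset (Fin n)) :
    (Finset.univ.filter fun j => gsVec v A j ≠ 0).card ≤ min d n := by
  refine le_min ?_ ((Finset.card_le_univ _).trans_eq (Fintype.card_fin n))
  have h := (orthonormal_gsVec v A).linearIndependent.fintype_card_le_finrank
  rw [finrank_euclideanSpace_fin] at h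
  rwa [Fintype.card_subtype] at h

end GSW

/-! ### The listing order along a run -/

namespace GSW

variable {n d : ℕ}

/-- The sets of unfrozen coordinates along a run: they decrease from everything to nothing. -/
structure IsRun (A : ℕ → Finset (Fin n)) : Prop where
  zero : A 0 = Finset.univ
  anti : Antitone A
  final : A n = ∅

lemma PivotAt.mem {A : ℕ → Finset (Fin n)} {p : Fin n} {t : ℕ} (h : PivotAt A p t) : p ∈ A t :=
  Finset.mem_of_max h

lemma PivotAt.le {A : ℕ → Finset (Fin n)} {p i : Fin n} {t : ℕ} (h : PivotAt A p t)
    (hi : i ∈ A t) : i ≤ p :=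
  Finset.le_max_of_eq hi h

lemma PivotAt.unique {A : ℕ → Finset (Fin n)} {p q : Fin n} {t : ℕ} (hp : PivotAt A p t)
    (hq : PivotAt A q t) : p = q :=
  le_antisymm (hq.le hp.mem) (hp.le hq.mem)

lemma PivotAt.of_mem {A : ℕ → Finset (Fin n)} {p : Fin n} {t : ℕ} (hp : p ∈ A t)
    (h : ∀ i ∈ A t, i ≤ p) : PivotAt A p t :=
  le_antisymm (Finset.max_le fun i hi => by exact_mod_cast h i hi) (Finset.le_max hp)

lemma exists_pivotAt {A : ℕ → Finset (Fin n)} {t : ℕ} (h : (A t).Nonempty) :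
    ∃ p, PivotAt A p t :=
  Finset.max_of_nonempty h

lemma PivotAt.mem_pivots {A : ℕ → Finset (Fin n)} {p : Fin n} {t : ℕ} (h : PivotAt A p t) :
    p ∈ pivots A := by
  simp only [pivots, Finset.mem_filter, Finset.mem_univ, true_and]
  exact ⟨t, h⟩

lemma mem_pivots {A : ℕ → Finset (Fin n)} {p : Fin n} : p ∈ pivots A ↔ ∃ t, PivotAt A p t := by
  simp [pivots]

lemma mem_frozenWith {A : ℕ → Finset (Fin n)} {p j : Fin n} {t : ℕ} :
    j ∈ frozenWith A p t ↔ j ≠ p ∧ j ∈ A t \ A (t + 1) := by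
  simp only [frozenWith, Finset.mem_erase]

/-- The first step with pivot `p`. -/
lemma exists_first_pivotAt {A : ℕ → Finset (Fin n)} {p : Fin n} (h : p ∈ pivots A) :
    ∃ t, PivotAt A p t ∧ (∀ r < t, ¬ PivotAt A p r) ∧ moment A p = 2 * t := by
  have hne : {t | PivotAt A p t}.Nonempty := mem_pivots.1 h
  refine ⟨sInf {t | PivotAt A p t}, Nat.sInf_mem hne, fun r hr => Nat.notMem_of_lt_sInf hr, ?_⟩
  rw [moment, if_pos h]

lemma PivotAt.moment_le {A : ℕ → Finset (Fin n)} {p : Fin n} {t : ℕ} (hp : PivotAt A p t) : moment A p ≤ 2 * t := by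
  obtain ⟨s, -, hs, hm⟩ := exists_first_pivotAt hp.mem_pivots
  have : s ≤ t := not_lt.1 fun h => hs t h hp
  omega

namespace IsRun

variable {A : ℕ → Finset (Fin n)} (hA : IsRun A)

include hA

lemma lt_of_mem {i : Fin n} {t : ℕ} (h : i ∈ A t) : t < n := by
  by_contra! hle
  have := hA.anti hle h
  simp [hA.final] at this

lemma frozen_unique {i : Fin n} {s t : ℕ} (hs : i ∈ A s \ A (s + 1)) (ht : i ∈ A t \ A (t + 1)) :
    s = t := by
  rw [Finset.mem_sdiff] at hs ht
  by_contra hne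
  rcases lt_or_gt_of_ne hne with h | h
  · exact hs.2 (hA.anti (Nat.succ_le_of_lt h) ht.1)
  · exact ht.2 (hA.anti (Nat.succ_le_of_lt h) hs.1)

lemma exists_frozen {i : Fin n} (hi : i ∉ pivots A) :
    ∃ t, i ∈ A t \ A (t + 1) ∧ moment A i = 2 * t + 1 := by
  classical
  have hne : {t | i ∈ A t \ A (t + 1)}.Nonempty := by
    have hex : ∃ t, i ∉ A t := ⟨n, by simp [hA.final]⟩
    have h0 : Nat.find hex ≠ 0 := by
      intro h0
      have := Nat.find_spec hex
      rw [h0, hA.zero] at this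
      exact this (Finset.mem_univ i)
    obtain ⟨t, ht⟩ := Nat.exists_eq_succ_of_ne_zero h0
    refine ⟨t, Finset.mem_sdiff.2 ⟨?_, ?_⟩⟩
    · exact not_not.1 (Nat.find_min hex (by omega))
    · have := Nat.find_spec hex
      rwa [ht] at this
  refine ⟨sInf {t | i ∈ A t \ A (t + 1)}, Nat.sInf_mem hne, ?_⟩
  rw [moment, if_neg hi]

/-- A pivot is the largest unfrozen index and the unfrozen sets only shrink, so it remains the pivot
for as long as it is unfrozen. -/
lemma eq_of_pivotAt_of_mem {p q : Fin n} {s t : ℕ} (hp : PivotAt A p t) (hq : PivotAt A q s)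
    (hst : s ≤ t) (h : q ∈ A t) : q = p :=
  le_antisymm (hp.le h) (hq.le (hA.anti hst hp.mem))

lemma notMem_pivots_of_mem_frozenWith {p j : Fin n} {t : ℕ} (hp : PivotAt A p t)
    (hj : j ∈ frozenWith A p t) : j ∉ pivots A := by
  intro hj'
  obtain ⟨hjp, hj⟩ := mem_frozenWith.1 hj
  rw [Finset.mem_sdiff] at hj
  obtain ⟨s, hs⟩ := mem_pivots.1 hj'
  rcases le_or_gt s t with h | h
  · exact hjp (hA.eq_of_pivotAt_of_mem hp hs h hj.1)
  · exact hj.2 (hA.anti h hs.mem)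

lemma moment_of_mem_frozenWith {p j : Fin n} {t : ℕ} (hp : PivotAt A p t)
    (hj : j ∈ frozenWith A p t) : moment A j = 2 * t + 1 := by
  obtain ⟨s, hs, hm⟩ := hA.exists_frozen (hA.notMem_pivots_of_mem_frozenWith hp hj)
  rw [hm, hA.frozen_unique hs (mem_frozenWith.1 hj).2]

/-- Holds at every step of the phase of p, not only the first: no other index becomes a pivot during
the phase. It identifies the span used by Gram–Schmidt with the span in `pivotImage`. -/
lemma lt_moment_iff {p : Fin n} {t : ℕ} (hp : PivotAt A p t) (i : Fin n) :
    2 * t < moment A i ↔ i ∈ (A t).erase p := by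
  rw [Finset.mem_erase]
  constructor
  · intro h
    refine ⟨?_, ?_⟩
    · rintro rfl
      exact absurd (hp.moment_le) (not_le.2 h)
    · by_cases hi : i ∈ pivots A
      · obtain ⟨s, hs, -, hm⟩ := exists_first_pivotAt hi
        exact hA.anti (by omega) hs.mem
      · obtain ⟨s, hs, hm⟩ := hA.exists_frozen hi
        exact hA.anti (by omega) (Finset.mem_sdiff.1 hs).1
  · rintro ⟨hip, hi⟩
    by_cases hi' : i ∈ pivots A
    · obtain ⟨s, hs, -, hm⟩ := exists_first_pivotAt hi'
      rw [hm]
      by_contra! hle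
      exact hip (hA.eq_of_pivotAt_of_mem hp hs (by omega) hi)
    · obtain ⟨s, hs, hm⟩ := hA.exists_frozen hi'
      have : t ≤ s := by
        by_contra! hlt
        exact (Finset.mem_sdiff.1 hs).2 (hA.anti hlt hi)
      omega

lemma succ_lt_moment_iff {p : Fin n} {t : ℕ} (hp : PivotAt A p t) (i : Fin n) :
    2 * t + 1 < moment A i ↔ i ∈ (A (t + 1)).erase p := by
  rw [Finset.mem_erase]
  constructor
  · intro h
    refine ⟨((Finset.mem_erase.1 ((hA.lt_moment_iff hp i).1 (by omega))).1), ?_⟩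
    by_cases hi : i ∈ pivots A
    · obtain ⟨s, hs, -, hm⟩ := exists_first_pivotAt hi
      exact hA.anti (by omega) hs.mem
    · obtain ⟨s, hs, hm⟩ := hA.exists_frozen hi
      exact hA.anti (by omega) (Finset.mem_sdiff.1 hs).1
  · rintro ⟨hip, hi⟩
    have h := (hA.lt_moment_iff hp i).2 (Finset.mem_erase.2 ⟨hip, hA.anti (Nat.le_succ t) hi⟩)
    by_contra! hle
    have hm : moment A i = 2 * t + 1 := by omega
    by_cases hi' : i ∈ pivots A
    · obtain ⟨s, hs, -, hm'⟩ := exists_first_pivotAt hi'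
      omega
    · obtain ⟨s, hs, hm'⟩ := hA.exists_frozen hi'
      obtain rfl : s = t := by omega
      exact (Finset.mem_sdiff.1 hs).2 hi

lemma blockSum_singleton (v : Fin n → EuclideanSpace ℝ (Fin d)) {p : Fin n} {t : ℕ}
    (hp : PivotAt A p t) (hfirst : ∀ r < t, ¬ PivotAt A p r) (y : EuclideanSpace ℝ (Fin d)) :
    blockSum v A p {p} y = inner ℝ (pivotImage v (A t) p) y := by
  have hm : moment A p = 2 * t := by
    obtain ⟨s, hs, hs', hm⟩ := exists_first_pivotAt hp.mem_pivots
    rcases lt_trichotomy s t with h | h | h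
    · exact absurd hs (hfirst s h)
    · rw [hm, h]
    · exact absurd hp (hs' t h)
  have hset : {j | ListedBefore A p j} = ((A t).erase p : Set (Fin n)) := by
    ext j
    rw [Finset.mem_coe, ← hA.lt_moment_iff hp j, Set.mem_ofPred_eq, ListedBefore, hm]
    refine ⟨fun h => h.resolve_right ?_, Or.inl⟩
    rintro ⟨hj, hlt⟩
    by_cases hj' : j ∈ pivots A
    · obtain ⟨s, hs, -, hm'⟩ := exists_first_pivotAt hj'
      obtain rfl : s = t := by omega
      exact hlt.ne (hs.unique hp)
    · obtain ⟨s, -, hm'⟩ := hA.exists_frozen hj'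
      omega
  rw [blockSum, Finset.sum_singleton, gsVec_eq_unitComponent, hset, ← real_inner_smul_left,
    inner_unitComponent_smul, pivotImage]

/-- The vectors listed after j ∈ `frozenWith A p t` are those still unfrozen after the step, without
p, and the smaller ones of the same block. Hence the block sum telescopes to the difference of the
projections of v_p before and after the step. -/
lemma blockSum_frozenWith (v : Fin n → EuclideanSpace ℝ (Fin d)) {p : Fin n} {t : ℕ}
    (hp : PivotAt A p t) (y : EuclideanSpace ℝ (Fin d)) :
    blockSum v A p (frozenWith A p t) y =
      inner ℝ (pivotImage v (A (t + 1)) p - pivotImage v (A t) p) y := by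
  have hset : ∀ j ∈ frozenWith A p t, {i | ListedBefore A j i} =
      ((A (t + 1)).erase p : Set (Fin n)) ∪ {i | i ∈ frozenWith A p t ∧ i < j} := by
    intro j hj
    ext i
    rw [Set.mem_union, Finset.mem_coe, ← hA.succ_lt_moment_iff hp i, Set.mem_ofPred_eq,
      Set.mem_ofPred_eq, ListedBefore, hA.moment_of_mem_frozenWith hp hj]
    refine or_congr_right (and_congr_left fun _ => ⟨fun hi => ?_, fun hi =>
      (hA.moment_of_mem_frozenWith hp hi).symm⟩)
    have h1 := (hA.lt_moment_iff hp i).1 (by omega)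
    have h2 := (hA.succ_lt_moment_iff hp i).not.1 (by omega)
    rw [Finset.mem_erase] at h1 h2
    rw [mem_frozenWith, Finset.mem_sdiff]
    tauto
  have hun : ((A (t + 1)).erase p : Set (Fin n)) ∪ (frozenWith A p t : Set (Fin n)) =
      ((A t).erase p : Set (Fin n)) := by
    ext i
    have hsub : A (t + 1) ⊆ A t := hA.anti (Nat.le_succ t)
    have := @hsub i
    simp only [Set.mem_union, Finset.mem_coe, mem_frozenWith, Finset.mem_erase, Finset.mem_sdiff]
    tauto
  have h := sum_inner_unitComponent_smul v ((A (t + 1)).erase p : Set (Fin n))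
    (frozenWith A p t) (v p)
  rw [hun] at h
  rw [pivotImage, pivotImage, sub_sub_sub_cancel_left, ← h, sum_inner, blockSum]
  refine Finset.sum_congr rfl fun j hj => ?_
  rw [gsVec_eq_unitComponent, hset j hj, real_inner_smul_left]

end IsRun

/-! ### Disjoint blocks and the bounds on `varProxy` and `nontrivSteps` -/

/-- The blocks of the pivot `p`. -/
def block (A : ℕ → Finset (Fin n)) (p : Fin n) : Option ℕ → Finset (Fin n)
  | none => {p}
  | some t => frozenWith A p t

/-- The index set of the blocks of `p`. -/
noncomputable def blockIdx (A : ℕ → Finset (Fin n)) (p : Fin n) : Finset (Option ℕ) :=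
  Finset.insertNone (pivotSteps A p)

lemma pivotAt_of_some_mem_blockIdx {A : ℕ → Finset (Fin n)} {p : Fin n} {t : ℕ}
    (h : some t ∈ blockIdx A p) : PivotAt A p t := by
  simp only [blockIdx, Finset.some_mem_insertNone, pivotSteps, Finset.mem_filter] at h
  exact h.2

/-- `∑ |blockSum|` over all blocks of `p`. -/
noncomputable def blockTotal (v : Fin n → EuclideanSpace ℝ (Fin d)) (A : ℕ → Finset (Fin n))
    (p : Fin n) (y : EuclideanSpace ℝ (Fin d)) : ℝ :=
  ∑ s ∈ blockIdx A p, |blockSum v A p (block A p s) y|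

lemma blockTotal_eq (v : Fin n → EuclideanSpace ℝ (Fin d)) (A : ℕ → Finset (Fin n))
    (p : Fin n) (y : EuclideanSpace ℝ (Fin d)) :
    blockTotal v A p y =
      |blockSum v A p {p} y| + ∑ t ∈ pivotSteps A p, |blockSum v A p (frozenWith A p t) y| :=
  Finset.sum_insertNone _ _

lemma varProxy_eq (v : Fin n → EuclideanSpace ℝ (Fin d)) (A : ℕ → Finset (Fin n))
    (y : EuclideanSpace ℝ (Fin d)) :
    varProxy v A y = ∑ p ∈ pivots A, blockTotal v A p y ^ 2 := by
  simp only [varProxy, blockTotal_eq]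

open scoped Classical in
lemma nontrivSteps_eq (v : Fin n → EuclideanSpace ℝ (Fin d)) (A : ℕ → Finset (Fin n)) :
    nontrivSteps v A =
      ∑ p ∈ pivots A, ∑ s ∈ blockIdx A p, if Nontriv v A (block A p s) then 1 else 0 := by
  refine Finset.sum_congr rfl fun p _ => ?_
  rw [blockIdx, Finset.sum_insertNone, Finset.card_filter]
  rfl

lemma IsRun.block_unique {A : ℕ → Finset (Fin n)} (hA : IsRun A) {p q j : Fin n}
    {s r : Option ℕ} (hp : p ∈ pivots A) (hq : q ∈ pivots A) (hs : s ∈ blockIdx A p)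
    (hr : r ∈ blockIdx A q) (hjs : j ∈ block A p s) (hjr : j ∈ block A q r) : p = q ∧ s = r := by
  match s, r with
  | none, none =>
    simp only [block, Finset.mem_singleton] at hjs hjr
    exact ⟨hjs ▸ hjr, rfl⟩
  | none, some t =>
    simp only [block, Finset.mem_singleton] at hjs
    exact absurd (hjs ▸ hp)
      (hA.notMem_pivots_of_mem_frozenWith (pivotAt_of_some_mem_blockIdx hr) hjr)
  | some t, none =>
    simp only [block, Finset.mem_singleton] at hjr
    exact absurd (hjr ▸ hq)
      (hA.notMem_pivots_of_mem_frozenWith (pivotAt_of_some_mem_blockIdx hs) hjs)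
  | some t, some t' =>
    obtain rfl := hA.frozen_unique (mem_frozenWith.1 hjs).2 (mem_frozenWith.1 hjr).2
    exact ⟨(pivotAt_of_some_mem_blockIdx hs).unique (pivotAt_of_some_mem_blockIdx hr), rfl⟩

section Sums

variable {R : Type*} [AddCommMonoid R] [PartialOrder R] [IsOrderedAddMonoid R]

lemma IsRun.sum_blocks_le {A : ℕ → Finset (Fin n)} (hA : IsRun A) {F : Fin n → R}
    (hF : ∀ j, 0 ≤ F j) :
    ∑ p ∈ pivots A, ∑ s ∈ blockIdx A p, ∑ j ∈ block A p s, F j ≤ ∑ j, F j := by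
  classical
  rw [Finset.sum_sigma', ← Finset.sum_biUnion]
  · exact Finset.sum_le_sum_of_subset_of_nonneg (Finset.subset_univ _) fun j _ _ => hF j
  · rintro ⟨p, s⟩ hps ⟨q, r⟩ hqr hne
    rw [Finset.mem_coe, Finset.mem_sigma] at hps hqr
    refine Finset.disjoint_left.2 fun j hj hj' => hne ?_
    obtain ⟨rfl, rfl⟩ := hA.block_unique hps.1 hqr.1 hps.2 hqr.2 hj hj'
    rfl

lemma IsRun.sum_blocks_of_pivot_le {A : ℕ → Finset (Fin n)} (hA : IsRun A) {F : Fin n → R}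
    (hF : ∀ j, 0 ≤ F j) {p : Fin n} (hp : p ∈ pivots A) :
    ∑ s ∈ blockIdx A p, ∑ j ∈ block A p s, F j ≤ ∑ j, F j :=
  (Finset.single_le_sum (f := fun p => ∑ s ∈ blockIdx A p, ∑ j ∈ block A p s, F j)
    (fun _ _ => Finset.sum_nonneg fun _ _ => Finset.sum_nonneg fun j _ => hF j) hp).trans
    (hA.sum_blocks_le hF)

end Sums

lemma varProxy_nonneg (v : Fin n → EuclideanSpace ℝ (Fin d)) (A : ℕ → Finset (Fin n))
    (y : EuclideanSpace ℝ (Fin d)) : 0 ≤ varProxy v A y :=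
  Finset.sum_nonneg fun _ _ => sq_nonneg _

lemma sum_blocks_inner_sq_le_one {v : Fin n → EuclideanSpace ℝ (Fin d)} (hv : ∀ i, ‖v i‖ ≤ 1)
    {A : ℕ → Finset (Fin n)} (hA : IsRun A) {p : Fin n} (hp : p ∈ pivots A) :
    ∑ s ∈ blockIdx A p, ∑ j ∈ block A p s, inner ℝ (gsVec v A j) (v p) ^ 2 ≤ 1 :=
  ((hA.sum_blocks_of_pivot_le (fun _ => sq_nonneg _) hp).trans
    (sum_inner_gsVec_sq_le v A (v p))).trans (pow_le_one₀ (norm_nonneg _) (hv p))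

lemma varProxy_le {v : Fin n → EuclideanSpace ℝ (Fin d)} (hv : ∀ i, ‖v i‖ ≤ 1)
    {A : ℕ → Finset (Fin n)} (hA : IsRun A) (y : EuclideanSpace ℝ (Fin d)) :
    varProxy v A y ≤ ‖y‖ ^ 2 := by
  rw [varProxy_eq]
  refine le_trans (Finset.sum_le_sum fun p hp => ?_)
    ((hA.sum_blocks_le (F := fun j => inner ℝ (gsVec v A j) y ^ 2) fun _ => sq_nonneg _).trans
      (sum_inner_gsVec_sq_le v A y))
  -- Cauchy–Schwarz inside each block and then over the blocks of p. The factor from v_p is at most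
  -- 1 by Bessel's inequality, and the factors from y sum to at most ‖y‖² because the blocks are
  -- disjoint.
  have h := Finset.sum_sq_le_sum_mul_sum_of_sq_le_mul (blockIdx A p)
    (r := fun s => |blockSum v A p (block A p s) y|)
    (f := fun s => ∑ j ∈ block A p s, inner ℝ (gsVec v A j) (v p) ^ 2)
    (g := fun s => ∑ j ∈ block A p s, inner ℝ (gsVec v A j) y ^ 2)
    (fun _ _ => Finset.sum_nonneg fun _ _ => sq_nonneg _)
    (fun _ _ => Finset.sum_nonneg fun _ _ => sq_nonneg _)
    (fun s _ => by rw [sq_abs]; exact Finset.sum_mul_sq_le_sq_mul_sq _ _ _)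
  refine h.trans (mul_le_of_le_one_left ?_ (sum_blocks_inner_sq_le_one hv hA hp))
  exact Finset.sum_nonneg fun _ _ => Finset.sum_nonneg fun _ _ => sq_nonneg _

/-- Each nontrivial block contains a nonzero w_j, the blocks are disjoint, and the nonzero w_j are
orthonormal. -/
lemma nontrivSteps_le (v : Fin n → EuclideanSpace ℝ (Fin d)) {A : ℕ → Finset (Fin n)}
    (hA : IsRun A) : nontrivSteps v A ≤ min d n := by
  classical
  refine le_trans ?_ (card_gsVec_ne_zero_le v A)
  rw [nontrivSteps_eq, Finset.card_filter]
  refine le_trans (Finset.sum_le_sum fun p _ => Finset.sum_le_sum fun s _ => ?_)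
    (hA.sum_blocks_le (F := fun j => if gsVec v A j ≠ 0 then 1 else 0) fun _ => Nat.zero_le _)
  split_ifs with h
  · obtain ⟨j, hj, hj0⟩ := h
    exact (if_pos hj0).ge.trans (Finset.single_le_sum
      (f := fun j => if gsVec v A j ≠ 0 then 1 else 0) (fun _ _ => Nat.zero_le _) hj)
  · exact Nat.zero_le _

lemma norm_sum_smul_gsVec_sq_le (v : Fin n → EuclideanSpace ℝ (Fin d)) (A : ℕ → Finset (Fin n))
    (Q : Finset (Fin n)) (c : Fin n → ℝ) :
    ‖∑ j ∈ Q, c j • gsVec v A j‖ ^ 2 ≤ ∑ j ∈ Q, c j ^ 2 := by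
  rw [← real_inner_self_eq_norm_sq, sum_inner]
  refine Finset.sum_le_sum fun j hj => ?_
  rw [inner_sum, Finset.sum_eq_single_of_mem j hj fun k _ hk => by
    rw [real_inner_smul_left, real_inner_smul_right, inner_gsVec_of_ne v A hk.symm]; simp]
  rw [real_inner_smul_left, real_inner_smul_right, real_inner_self_eq_norm_sq, ← mul_assoc, ← sq]
  refine mul_le_of_le_one_right (sq_nonneg _) ?_
  by_cases h0 : gsVec v A j = 0
  · simp [h0]
  · rw [show ‖gsVec v A j‖ = 1 from norm_unitComponent h0, one_pow]

lemma sum_varProxy_single_le {v : Fin n → EuclideanSpace ℝ (Fin d)} (hv : ∀ i, ‖v i‖ ≤ 1)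
    {A : ℕ → Finset (Fin n)} (hA : IsRun A) :
    ∑ i : Fin d, varProxy v A (EuclideanSpace.single i 1) ≤ nontrivSteps v A := by
  classical
  set a : Fin n → Option ℕ → ℝ := fun p s =>
    ∑ j ∈ block A p s, inner ℝ (gsVec v A j) (v p) ^ 2 with ha
  have ha0 : ∀ p s, 0 ≤ a p s := fun p s => Finset.sum_nonneg fun _ _ => sq_nonneg _
  set g : Fin n → Option ℕ → EuclideanSpace ℝ (Fin d) := fun p s =>
    ∑ j ∈ block A p s, inner ℝ (gsVec v A j) (v p) • gsVec v A j with hg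
  have hb : ∀ p s (i : Fin d),
      blockSum v A p (block A p s) (EuclideanSpace.single i 1) = g p s i := by
    intro p s i
    have : inner ℝ (g p s) (EuclideanSpace.single i (1 : ℝ)) = g p s i := by
      simp [EuclideanSpace.inner_single_right]
    rw [← this, hg, sum_inner, blockSum]
    simp only [real_inner_smul_left]
  have hga : ∀ p s, ‖g p s‖ ^ 2 ≤ a p s := fun p s => norm_sum_smul_gsVec_sq_le v A _ _
  have hgi : ∀ p s, ∑ i, g p s i ^ 2 = ‖g p s‖ ^ 2 := by
    intro p s
    rw [EuclideanSpace.norm_sq_eq]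
    simp
  -- Cauchy–Schwarz with weights `a p s`, which sum to at most 1 over s. These weights do not depend
  -- on i, so summing over i turns each block into ‖g‖²/a, at most 1 for a nontrivial block and 0
  -- otherwise.
  have key : ∀ i, varProxy v A (EuclideanSpace.single i 1) ≤
      ∑ p ∈ pivots A, ∑ s ∈ blockIdx A p, g p s i ^ 2 / a p s := by
    intro i
    rw [varProxy_eq]
    refine Finset.sum_le_sum fun p hp => ?_
    have h := Finset.sum_sq_le_sum_mul_sum_of_sq_le_mul (blockIdx A p)
      (r := fun s => |blockSum v A p (block A p s) (EuclideanSpace.single i 1)|)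
      (f := a p) (g := fun s => g p s i ^ 2 / a p s) (fun s _ => ha0 p s)
      (fun s _ => div_nonneg (sq_nonneg _) (ha0 p s)) (fun s _ => by
        rw [sq_abs, hb]
        -- A block of weight 0 has g = 0, so the convention that division by 0 gives 0 is harmless.
        rcases (ha0 p s).eq_or_lt with h0 | h0
        · have h1 : g p s i ^ 2 ≤ ‖g p s‖ ^ 2 := by
            rw [← hgi]
            exact Finset.single_le_sum (f := fun i => g p s i ^ 2) (fun _ _ => sq_nonneg _)
              (Finset.mem_univ i)
          rw [← h0, zero_mul]
          exact h1.trans ((hga p s).trans h0.ge)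
        · rw [mul_div_cancel₀ _ h0.ne'])
    refine h.trans (mul_le_of_le_one_left ?_ (sum_blocks_inner_sq_le_one hv hA hp))
    exact Finset.sum_nonneg fun s _ => div_nonneg (sq_nonneg _) (ha0 p s)
  refine (Finset.sum_le_sum fun i _ => key i).trans ?_
  rw [Finset.sum_comm, nontrivSteps_eq]
  push_cast
  refine Finset.sum_le_sum fun p hp => ?_
  rw [Finset.sum_comm]
  refine Finset.sum_le_sum fun s _ => ?_
  rw [← Finset.sum_div, hgi]
  split_ifs with h
  · exact div_le_one_of_le₀ (hga p s) (ha0 p s)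
  · have : a p s = 0 := Finset.sum_eq_zero fun j hj => by
      have : gsVec v A j = 0 := by
        by_contra h0
        exact h ⟨j, hj, h0⟩
      simp [this]
    rw [this, div_zero]

/-- Cauchy–Schwarz over the pivots: a pivot with nonzero total has a nontrivial block and so
contributes at least 1 to T̂. -/
lemma sq_sum_blockTotal_le (v : Fin n → EuclideanSpace ℝ (Fin d)) (A : ℕ → Finset (Fin n))
    (y : EuclideanSpace ℝ (Fin d)) :
    (∑ p ∈ pivots A, blockTotal v A p y) ^ 2 ≤ nontrivSteps v A * varProxy v A y := by
  classical
  rw [nontrivSteps_eq, varProxy_eq]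
  push_cast
  refine Finset.sum_sq_le_sum_mul_sum_of_sq_le_mul _ (fun p _ => Finset.sum_nonneg fun s _ => ?_)
    (fun p _ => sq_nonneg _) fun p _ => ?_
  · split_ifs <;> norm_num
  · by_cases h : ∃ s ∈ blockIdx A p, Nontriv v A (block A p s)
    · obtain ⟨s, hs, hs'⟩ := h
      refine le_mul_of_one_le_left (sq_nonneg _) ?_
      refine (if_pos hs').ge.trans (Finset.single_le_sum
        (f := fun s => if Nontriv v A (block A p s) then (1 : ℝ) else 0) (fun s _ => ?_) hs)
      split_ifs <;> norm_num
    · have : blockTotal v A p y = 0 := Finset.sum_eq_zero fun s hs => by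
        rw [abs_eq_zero]
        refine Finset.sum_eq_zero fun j hj => ?_
        have : gsVec v A j = 0 := by
          by_contra h0
          exact h ⟨s, hs, j, hj, h0⟩
        simp [this]
      rw [this]
      simp

end GSW

/-! ### Steps of the walk and its law -/

namespace GSW

open Filter Topology

variable {n d : ℕ}

lemma mem_unfrozen {x : Fin n → ℝ} {i : Fin n} : i ∈ unfrozen x ↔ |x i| < 1 := by
  simp [unfrozen]

lemma abs_eq_one_of_notMem_unfrozen {x : Fin n → ℝ} (hx : ∀ i, |x i| ≤ 1) {i : Fin n}
    (hi : i ∉ unfrozen x) : |x i| = 1 :=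
  (hx i).antisymm (not_lt.1 fun h => hi (mem_unfrozen.2 h))

lemma mem_stepSet {x y : Fin n → ℝ} {δ : ℝ} : δ ∈ stepSet x y ↔ ∀ i, |x i + δ * y i| ≤ 1 :=
  forall_congr' fun _ => abs_le.symm

lemma stepSet_mem_nhds {x y : Fin n → ℝ} (hx : ∀ i, |x i| ≤ 1) (hy : ∀ i ∉ unfrozen x, y i = 0)
    {δ : ℝ} (hδ : ∀ i ∈ unfrozen x, |x i + δ * y i| < 1) : stepSet x y ∈ 𝓝 δ := by
  have h : ∀ i, ∀ᶠ ε in 𝓝 δ, |x i + ε * y i| ≤ 1 := by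
    intro i
    by_cases hi : i ∈ unfrozen x
    · have hc : ContinuousAt (fun ε : ℝ => |x i + ε * y i|) δ := by fun_prop
      exact (hc.eventually_lt_const (hδ i hi)).mono fun _ h => h.le
    · simp [hy i hi, hx i]
  filter_upwards [eventually_all.2 h] with ε hε
  exact mem_stepSet.2 hε

lemma isCompact_stepSet (x : Fin n → ℝ) {y : Fin n → ℝ} {p : Fin n} (hp : y p ≠ 0) :
    IsCompact (stepSet x y) := by
  have hclosed : IsClosed (stepSet x y) := by
    have : stepSet x y = ⋂ i, {δ | x i + δ * y i ∈ Set.Icc (-1 : ℝ) 1} := by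
      ext; simp [stepSet]
    rw [this]
    exact isClosed_iInter fun i => isClosed_Icc.preimage (by fun_prop)
  refine (isCompact_closedBall (0 : ℝ) ((1 + |x p|) / |y p|)).of_isClosed_subset hclosed ?_
  intro δ hδ
  rw [mem_closedBall_zero_iff, Real.norm_eq_abs, le_div_iff₀ (abs_pos.2 hp), ← abs_mul]
  have h1 := mem_stepSet.1 hδ p
  calc |δ * y p| = |(x p + δ * y p) - x p| := by ring_nf
    _ ≤ |x p + δ * y p| + |x p| := abs_sub _ _
    _ ≤ 1 + |x p| := by gcongr

/-- The step set is compact and a neighbourhood of 0. At its maximum some unfrozen coordinate must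
reach ±1, for otherwise a slightly larger step would be possible. -/
lemma stepPos_spec {x y : Fin n → ℝ} (hx : ∀ i, |x i| ≤ 1) (hy : ∀ i ∉ unfrozen x, y i = 0)
    {p : Fin n} (hp : y p ≠ 0) :
    0 < stepPos x y ∧ (∀ i, |x i + stepPos x y * y i| ≤ 1) ∧
      ∃ i ∈ unfrozen x, |x i + stepPos x y * y i| = 1 := by
  have hcomp := isCompact_stepSet x hp
  have h0 : stepSet x y ∈ 𝓝 (0 : ℝ) :=
    stepSet_mem_nhds hx hy fun i hi => by simpa using mem_unfrozen.1 hi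
  have hbig : ∀ {δ : ℝ}, stepSet x y ∈ 𝓝 δ → δ < sSup (stepSet x y) := by
    intro δ hδ
    obtain ⟨ε, hε, hs⟩ := Metric.mem_nhds_iff.1 hδ
    have : δ + ε / 2 ∈ stepSet x y := hs (by
      rw [Metric.mem_ball, Real.dist_eq]
      rw [add_sub_cancel_left, abs_of_pos (by positivity)]
      linarith)
    have := le_csSup hcomp.bddAbove this
    linarith
  have hpos := hbig h0
  have hmem := hcomp.sSup_mem ⟨0, mem_of_mem_nhds h0⟩
  rw [stepPos, abs_of_pos hpos]
  refine ⟨hpos, mem_stepSet.1 hmem, ?_⟩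
  by_contra! hne
  exact lt_irrefl _ (hbig (stepSet_mem_nhds hx hy fun i hi =>
    (mem_stepSet.1 hmem i).lt_of_ne (hne i hi)))

lemma stepNeg_eq_stepPos_neg (x y : Fin n → ℝ) : stepNeg x y = stepPos x (-y) := by
  have : stepSet x (-y) = -stepSet x y := by
    ext δ
    simp [stepSet]
  rw [stepNeg, stepPos, this, Real.sInf_def, abs_neg]

/-- The signed step size for the outcome `b` of the coin. -/
noncomputable def signedStep (x y : Fin n → ℝ) (b : Bool) : ℝ :=
  if b = true then stepPos x y else -stepNeg x y

lemma signedStep_spec {x y : Fin n → ℝ} (hx : ∀ i, |x i| ≤ 1) (hy : ∀ i ∉ unfrozen x, y i = 0)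
    {p : Fin n} (hp : y p ≠ 0) (b : Bool) :
    (∀ i, |x i + signedStep x y b * y i| ≤ 1) ∧
      ∃ i ∈ unfrozen x, |x i + signedStep x y b * y i| = 1 := by
  cases b
  · have := (stepPos_spec (y := -y) hx (by simpa using hy) (p := p) (by simpa using hp)).2
    simpa [signedStep, stepNeg_eq_stepPos_neg] using this
  · simpa [signedStep] using (stepPos_spec hx hy hp).2

section Walk

variable {v : Fin n → EuclideanSpace ℝ (Fin d)} {u : (Fin n → ℝ) → Fin n → ℝ}

lemma next_eq {x : Fin n → ℝ} (h : (unfrozen x).Nonempty) (b : Bool) :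
    next u x b = x + signedStep x (u x) b • u x := by
  cases b <;> simp [next, signedStep, h, sub_eq_add_neg]

lemma next_of_eq_empty {x : Fin n → ℝ} (h : unfrozen x = ∅) (b : Bool) : next u x b = x := by
  simp [next, h]

lemma coinProb_nonneg {x : Fin n → ℝ} (b : Bool) :
    0 ≤ coinProb u x b := by
  unfold coinProb
  have h1 : 0 ≤ stepPos x (u x) := abs_nonneg _
  have h2 : 0 ≤ stepNeg x (u x) := abs_nonneg _
  split_ifs <;> positivity

namespace IsDirectionRule

variable (hu : IsDirectionRule v u)

include hu

lemma apply_pivot {x : Fin n → ℝ} {p : Fin n} (hp : (unfrozen x).max = p) : u x p = 1 :=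
  (hu x ⟨p, Finset.mem_of_max hp⟩).1.1 p hp

lemma stepPos_pos {x : Fin n → ℝ} (hx : ∀ i, |x i| ≤ 1) (h : (unfrozen x).Nonempty) :
    0 < stepPos x (u x) := by
  obtain ⟨p, hp⟩ := Finset.max_of_nonempty h
  exact (stepPos_spec hx (hu x h).1.2 (p := p) (by rw [hu.apply_pivot hp]; exact one_ne_zero)).1

lemma stepNeg_pos {x : Fin n → ℝ} (hx : ∀ i, |x i| ≤ 1) (h : (unfrozen x).Nonempty) :
    0 < stepNeg x (u x) := by
  obtain ⟨p, hp⟩ := Finset.max_of_nonempty h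
  rw [stepNeg_eq_stepPos_neg]
  refine (stepPos_spec hx (fun i hi => ?_) (p := p) ?_).1
  · rw [Pi.neg_apply, (hu x h).1.2 i hi, neg_zero]
  · rw [Pi.neg_apply, hu.apply_pivot hp]
    norm_num

lemma coinProb_add {x : Fin n → ℝ} (hx : ∀ i, |x i| ≤ 1) :
    coinProb u x true + coinProb u x false = 1 := by
  by_cases h : (unfrozen x).Nonempty
  · have h1 := hu.stepPos_pos hx h
    have h2 := hu.stepNeg_pos hx h
    simp only [coinProb, h, if_true]
    simp
    field_simp
  · simp only [coinProb, h, if_false]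
    norm_num

lemma coinProb_mul_signedStep {x : Fin n → ℝ} (hx : ∀ i, |x i| ≤ 1) (h : (unfrozen x).Nonempty) :
    coinProb u x true * signedStep x (u x) true + coinProb u x false * signedStep x (u x) false =
      0 := by
  have h1 := hu.stepPos_pos hx h
  have h2 := hu.stepNeg_pos hx h
  simp only [coinProb, h, if_true, signedStep]
  simp
  field_simp
  ring

lemma abs_next_le {x : Fin n → ℝ} (hx : ∀ i, |x i| ≤ 1) (b : Bool) (i : Fin n) :
    |next u x b i| ≤ 1 := by
  rcases (unfrozen x).eq_empty_or_nonempty with h | h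
  · rw [next_of_eq_empty h]
    exact hx i
  · obtain ⟨p, hp⟩ := Finset.max_of_nonempty h
    rw [next_eq h]
    exact (signedStep_spec hx (hu x h).1.2 (p := p)
      (by rw [hu.apply_pivot hp]; exact one_ne_zero) b).1 i

lemma unfrozen_next_subset {x : Fin n → ℝ} (hx : ∀ i, |x i| ≤ 1) (b : Bool) :
    unfrozen (next u x b) ⊆ unfrozen x := by
  rcases (unfrozen x).eq_empty_or_nonempty with h | h
  · rw [next_of_eq_empty h]
  · intro i hi
    by_contra hi'
    have h1 := abs_eq_one_of_notMem_unfrozen hx hi'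
    rw [mem_unfrozen, next_eq h] at hi
    simp only [Pi.add_apply, Pi.smul_apply, (hu x h).1.2 i hi', smul_zero, add_zero] at hi
    exact hi.ne h1

lemma unfrozen_next_ssubset {x : Fin n → ℝ} (hx : ∀ i, |x i| ≤ 1) (h : (unfrozen x).Nonempty)
    (b : Bool) : unfrozen (next u x b) ⊂ unfrozen x := by
  obtain ⟨p, hp⟩ := Finset.max_of_nonempty h
  obtain ⟨i, hi, hi1⟩ := (signedStep_spec hx (hu x h).1.2 (p := p)
    (by rw [hu.apply_pivot hp]; exact one_ne_zero) b).2
  refine (hu.unfrozen_next_subset hx b).ssubset_of_mem_notMem hi fun hi' => ?_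
  rw [Finset.mem_coe, mem_unfrozen, next_eq h] at hi'
  exact hi'.ne hi1

/-- The walk moves along the component of the pivot vector orthogonal to the span of the other
unfrozen vectors. -/
lemma combo_eq_pivotImage {x : Fin n → ℝ} {p : Fin n} (hp : (unfrozen x).max = p) :
    combo v (u x) = pivotImage v (unfrozen x) p := by
  classical
  have hpm : p ∈ unfrozen x := Finset.mem_of_max hp
  obtain ⟨hadm, hmin⟩ := hu x ⟨p, hpm⟩
  set W := Submodule.span ℝ (v '' ((unfrozen x).erase p)) with hW
  set r := pivotImage v (unfrozen x) p with hr
  have hrW : ∀ z ∈ W, inner ℝ r z = 0 := fun z hz =>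
    Submodule.starProjection_inner_eq_zero _ z hz
  have hsplit : ∀ y ∈ admissible x, combo v y = v p + ∑ i ∈ (unfrozen x).erase p, y i • v i := by
    intro y hy
    rw [combo, ← Finset.sum_subset (Finset.subset_univ (unfrozen x)) fun i _ hi => by
      rw [hy.2 i hi, zero_smul], ← Finset.add_sum_erase _ _ hpm, hy.1 p hp, one_smul]
  have hmemW : ∀ y : Fin n → ℝ, ∑ i ∈ (unfrozen x).erase p, y i • v i ∈ W := fun y =>
    Submodule.sum_mem _ fun i hi => Submodule.smul_mem _ _
      (Submodule.subset_span (Set.mem_image_of_mem v hi))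
  obtain ⟨y, hy, hyr⟩ : ∃ y ∈ admissible x, combo v y = r := by
    obtain ⟨c, hc⟩ : ∃ c : Fin n → ℝ, ∑ i ∈ (unfrozen x).erase p, c i • v i =
        W.starProjection (v p) := by
      have hPW : W.starProjection (v p) ∈ W := W.starProjection_apply_mem _
      obtain ⟨c, hc⟩ := (Submodule.mem_span_image_finset_iff_exists_fun ℝ).1 hPW
      refine ⟨fun i => if h : i ∈ (unfrozen x).erase p then c ⟨i, h⟩ else 0, ?_⟩
      rw [← hc, ← Finset.sum_coe_sort]
      exact Finset.sum_congr rfl fun i _ => by beta_reduce; rw [dif_pos i.2]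
    let y : Fin n → ℝ := fun i => if i = p then 1 else if i ∈ unfrozen x then -c i else 0
    have hyadm : y ∈ admissible x := by
      refine ⟨fun q hq => ?_, fun i hi => ?_⟩
      · have : p = q := by
          have := hp.symm.trans hq
          exact_mod_cast this
        simp [y, this]
      · have : i ≠ p := fun h => hi (h ▸ hpm)
        simp [y, this, hi]
    refine ⟨y, hyadm, ?_⟩
    have hrc : r = v p - ∑ i ∈ (unfrozen x).erase p, c i • v i := by rw [hc, hr, pivotImage]
    rw [hsplit y hyadm, hrc, sub_eq_add_neg, ← Finset.sum_neg_distrib]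
    congr 1
    refine Finset.sum_congr rfl fun i hi => ?_
    rw [Finset.mem_erase] at hi
    simp [y, hi.1, hi.2]
  have hdiff : combo v (u x) - r ∈ W := by
    rw [← hyr, hsplit _ hadm, hsplit _ hy, add_sub_add_left_eq_sub]
    exact W.sub_mem (hmemW _) (hmemW _)
  have hle : ‖combo v (u x)‖ ≤ ‖r‖ := by
    have := hmin hy
    simpa [hyr] using this
  have hpyth : ‖combo v (u x)‖ * ‖combo v (u x)‖ =
      ‖r‖ * ‖r‖ + ‖combo v (u x) - r‖ * ‖combo v (u x) - r‖ := by
    rw [← norm_add_sq_eq_norm_sq_add_norm_sq_of_inner_eq_zero _ _ (hrW _ hdiff), add_sub_cancel]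
  -- The residual r is itself attained by an admissible direction, so minimality and Pythagoras
  -- force the image of any minimiser to equal r, whatever the tie-breaking rule.
  have h0 : ‖combo v (u x) - r‖ = 0 := by
    have h1 := mul_self_le_mul_self (norm_nonneg _) hle
    nlinarith [norm_nonneg (combo v (u x) - r)]
  exact sub_eq_zero.1 (norm_eq_zero.1 h0)

lemma abs_position_le (ω : Fin n → Bool) (t : ℕ) (i : Fin n) : |position u ω t i| ≤ 1 := by
  induction t generalizing i with
  | zero => simp [position]
  | succ t ih =>
    rw [position]
    split_ifs with h
    · exact hu.abs_next_le ih _ i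
    · exact ih i

lemma isRun_active (ω : Fin n → Bool) : IsRun (active u ω) := by
  have hsub : ∀ t, active u ω (t + 1) ⊆ active u ω t := by
    intro t
    rw [active, position]
    split_ifs with h
    · exact hu.unfrozen_next_subset (hu.abs_position_le ω t) _
    · exact subset_rfl
  have hcard : ∀ t ≤ n, (active u ω t).card ≤ n - t := by
    intro t
    induction t with
    | zero => intro _; exact (Finset.card_le_univ _).trans_eq (Fintype.card_fin n)
    | succ t ih =>
      intro ht
      have h1 := ih (by omega)
      rcases (active u ω t).eq_empty_or_nonempty with h | h
      · have h2 := hsub t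
        rw [h, Finset.subset_empty] at h2
        simp [h2]
      · have h2 : active u ω (t + 1) ⊂ active u ω t := by
          rw [active, position, dif_pos (by omega)]
          exact hu.unfrozen_next_ssubset (hu.abs_position_le ω t) h _
        have := Finset.card_lt_card h2
        omega
  refine ⟨?_, antitone_nat_of_succ_le hsub, ?_⟩
  · ext i
    simp [active, position, mem_unfrozen]
  · have := hcard n le_rfl
    rw [Nat.sub_self, Nat.le_zero, Finset.card_eq_zero] at this
    exact this

lemma position_final (ω : Fin n → Bool) (i : Fin n) :
    position u ω n i = 1 ∨ position u ω n i = -1 := by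
  refine eq_or_eq_neg_of_abs_eq (abs_eq_one_of_notMem_unfrozen (hu.abs_position_le ω n) ?_)
  have : unfrozen (position u ω n) = ∅ := (hu.isRun_active ω).final
  simp [this]

end IsDirectionRule

lemma position_update (ω : Fin n → Bool) (t : Fin n) (b : Bool) {s : ℕ} (hs : s ≤ t) :
    position u (Function.update ω t b) s = position u ω s := by
  induction s with
  | zero => rfl
  | succ s ih =>
    have hne : (⟨s, by omega⟩ : Fin n) ≠ t := by
      intro h
      have := congrArg Fin.val h
      simp only at this
      omega
    rw [position, position, dif_pos (by omega), dif_pos (by omega), ih (by omega),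
      Function.update_of_ne hne]

/-- A supermartingale indexed by the steps of the walk has decreasing expectation. -/
lemma expect_le (Ψ : ℕ → (Fin n → Bool) → ℝ) (c : ℝ)
    (h0 : ∀ ω, Ψ 0 ω ≤ c)
    (hstep : ∀ (t : Fin n) ω,
      coinProb u (position u ω t) true * Ψ (t + 1) (Function.update ω t true) +
        coinProb u (position u ω t) false * Ψ (t + 1) (Function.update ω t false) ≤ Ψ t ω) :
    expect u (Ψ n) ≤ c := by
  classical
  -- Probability of the first t coins only. No adaptedness of Ψ is needed, since the step hypothesis
  -- is required for every ω.
  let w : ℕ → (Fin n → Bool) → ℝ := fun t ω =>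
    ∏ s ∈ Finset.univ.filter fun s : Fin n => (s : ℕ) < t, coinProb u (position u ω s) (ω s)
  have hw0 : ∀ t ω, 0 ≤ w t ω := fun t ω => Finset.prod_nonneg fun s _ => coinProb_nonneg _
  have hwupd : ∀ (t : Fin n) ω b, w (t + 1) (Function.update ω t b) =
      w t ω * coinProb u (position u ω t) b := by
    intro t ω b
    have hins : (Finset.univ.filter fun s : Fin n => (s : ℕ) < t + 1) =
        insert t (Finset.univ.filter fun s : Fin n => (s : ℕ) < t) := by
      ext s
      simp only [Finset.mem_filter, Finset.mem_univ, true_and, Finset.mem_insert, Fin.ext_iff]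
      omega
    simp only [w]
    rw [hins, Finset.prod_insert (by simp), position_update ω t b le_rfl, Function.update_self,
      mul_comm]
    congr 1
    refine Finset.prod_congr rfl fun s hs => ?_
    have hst : (s : ℕ) < t := by simpa using hs
    rw [position_update ω t b hst.le, Function.update_of_ne (by rintro rfl; simp at hst)]
  have hflip : ∀ (t : Fin n) (f : (Fin n → Bool) → ℝ), 2 * ∑ ω, f ω =
      ∑ ω, (f (Function.update ω t true) + f (Function.update ω t false)) := by
    intro t f
    let e : Equiv.Perm (Fin n → Bool) := Function.Involutive.toPerm
      (fun ω => Function.update ω t (!ω t)) (fun ω => by simp)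
    have h1 : ∑ ω, f (e ω) = ∑ ω, f ω := Equiv.sum_comp e f
    rw [two_mul]
    nth_rewrite 2 [← h1]
    rw [← Finset.sum_add_distrib]
    refine Finset.sum_congr rfl fun ω _ => ?_
    have he : e ω = Function.update ω t (!ω t) := rfl
    have hself : Function.update ω t (ω t) = ω := Function.update_eq_self t ω
    rw [he]
    cases hb : ω t
    · rw [hb] at hself
      rw [hself, Bool.not_false, add_comm]
    · rw [hb] at hself
      rw [hself, Bool.not_true]
  -- Summing over all n coins counts each prefix of length t exactly 2^(n-t) times; the factor 2^t
  -- normalises this. Pairing every ω with its flip at coin t gives the induction step.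
  have key : ∀ t ≤ n, 2 ^ t * ∑ ω, w t ω * Ψ t ω ≤ 2 ^ n * c := by
    intro t
    induction t with
    | zero =>
      intro _
      have : ∑ ω : Fin n → Bool, w 0 ω * Ψ 0 ω ≤ ∑ _ω : Fin n → Bool, c :=
        Finset.sum_le_sum fun ω _ => by simpa [w] using h0 ω
      simpa using this
    | succ t ih =>
      intro ht
      refine le_trans ?_ (ih (by omega))
      rw [pow_succ, mul_assoc]
      refine mul_le_mul_of_nonneg_left ?_ (by positivity)
      rw [hflip ⟨t, ht⟩]
      refine Finset.sum_le_sum fun ω _ => ?_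
      have h1 := hwupd ⟨t, ht⟩ ω
      have h2 := mul_le_mul_of_nonneg_left (hstep ⟨t, ht⟩ ω) (hw0 t ω)
      simp only at h1 h2
      rw [h1, h1]
      refine le_trans (le_of_eq ?_) h2
      ring
  have h := key n le_rfl
  have hwn : ∀ ω, w n ω = prob u ω := fun ω => by simp [w, prob]
  simp only [hwn] at h
  exact le_of_mul_le_mul_left h (by positivity)

lemma prob_nonneg (ω : Fin n → Bool) : 0 ≤ prob u ω :=
  Finset.prod_nonneg fun _ _ => coinProb_nonneg _

lemma IsDirectionRule.sum_prob (hu : IsDirectionRule v u) : ∑ ω, prob u ω = 1 := by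
  -- Constants are martingales; 1 and -1 give the two inequalities.
  have h1 := expect_le (fun _ _ => 1) 1 (fun _ => le_rfl) fun t ω => by
    rw [mul_one, mul_one, hu.coinProb_add (hu.abs_position_le ω t)]
  have h2 := expect_le (fun _ _ => -1) (-1) (fun _ => le_rfl) fun t ω => by
    have := hu.coinProb_add (hu.abs_position_le ω t)
    linarith
  simp only [expect, mul_one, mul_neg, Finset.sum_neg_distrib] at h1 h2
  linarith

end Walk

end GSW

/-! ### Accumulated weights and the exponential supermartingale -/

namespace GSW

open Real

variable {n d : ℕ}

section Weights

variable (v : Fin n → EuclideanSpace ℝ (Fin d)) (A : ℕ → Finset (Fin n))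
  (y : EuclideanSpace ℝ (Fin d))

open scoped Classical in
/-- The contribution of the block `{p}`, if `p` becomes the pivot at step `s`. -/
noncomputable def firstWeight (p : Fin n) (s : ℕ) : ℝ :=
  if PivotAt A p s ∧ ∀ r < s, ¬ PivotAt A p r then |inner ℝ (pivotImage v (A s) p) y| else 0

open scoped Classical in
/-- The contribution of the coordinates frozen in step `s`, if `p` is the pivot of this step. -/
noncomputable def freezeWeight (p : Fin n) (s : ℕ) : ℝ :=
  if PivotAt A p s then |inner ℝ (pivotImage v (A (s + 1)) p - pivotImage v (A s) p) y| else 0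

/-- The part of `blockTotal` that is determined by the first `t` steps. -/
noncomputable def weight (t : ℕ) (p : Fin n) : ℝ :=
  ∑ s ∈ Finset.range (t + 1), firstWeight v A y p s + ∑ s ∈ Finset.range t, freezeWeight v A y p s

lemma firstWeight_nonneg (p : Fin n) (s : ℕ) : 0 ≤ firstWeight v A y p s := by
  unfold firstWeight; split_ifs <;> positivity

lemma freezeWeight_nonneg (p : Fin n) (s : ℕ) : 0 ≤ freezeWeight v A y p s := by
  unfold freezeWeight; split_ifs <;> positivity

lemma weight_nonneg (t : ℕ) (p : Fin n) : 0 ≤ weight v A y t p :=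
  add_nonneg (Finset.sum_nonneg fun _ _ => firstWeight_nonneg ..)
    (Finset.sum_nonneg fun _ _ => freezeWeight_nonneg ..)

lemma weight_succ (t : ℕ) (p : Fin n) : weight v A y (t + 1) p =
    weight v A y t p + freezeWeight v A y p t + firstWeight v A y p (t + 1) := by
  rw [weight, weight, Finset.sum_range_succ (firstWeight v A y p) (t + 1),
    Finset.sum_range_succ (freezeWeight v A y p) t]
  ring

lemma weight_le_succ (t : ℕ) (p : Fin n) : weight v A y t p ≤ weight v A y (t + 1) p := by
  rw [weight_succ]
  linarith [freezeWeight_nonneg v A y p t, firstWeight_nonneg v A y p (t + 1)]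

variable {A}

/-- The ranges in `weight` are chosen for this: the pivot of step t is visible in `A t`, but what
step t freezes only in `A (t + 1)`, so at time t the first sum includes s = t and the second does
not. -/
lemma weight_congr {A' : ℕ → Finset (Fin n)} {t : ℕ} (h : ∀ s ≤ t, A s = A' s) (p : Fin n) :
    weight v A y t p = weight v A' y t p := by
  classical
  have hp : ∀ s ≤ t, (PivotAt A p s ↔ PivotAt A' p s) := fun s hs => by
    rw [PivotAt, PivotAt, h s hs]
  unfold weight
  congr 1
  · refine Finset.sum_congr rfl fun s hs => ?_
    have hs' : s ≤ t := by simpa [Nat.lt_succ_iff] using hs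
    unfold firstWeight
    rw [h s hs']
    refine if_congr (and_congr (hp s hs') (forall₂_congr fun r hr => ?_)) rfl rfl
    rw [hp r (hr.le.trans hs')]
  · refine Finset.sum_congr rfl fun s hs => ?_
    have hs' : s < t := by simpa using hs
    unfold freezeWeight
    rw [h s hs'.le, h (s + 1) hs']
    exact if_congr (hp s hs'.le) rfl rfl

lemma weight_final (hA : IsRun A) {p : Fin n} (hp : p ∈ pivots A) :
    weight v A y n p = blockTotal v A p y := by
  classical
  rw [blockTotal_eq, weight]
  congr 1
  · obtain ⟨t, ht, hfirst, -⟩ := exists_first_pivotAt hp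
    rw [Finset.sum_eq_single_of_mem t
      (Finset.mem_range.2 ((hA.lt_of_mem ht.mem).trans (Nat.lt_succ_self n)))]
    · rw [firstWeight, if_pos ⟨ht, hfirst⟩, hA.blockSum_singleton v ht hfirst]
    · rintro s - hs
      refine if_neg fun ⟨h1, h2⟩ => ?_
      rcases lt_or_gt_of_ne hs with h | h
      · exact hfirst s h h1
      · exact h2 t h ht
  · rw [pivotSteps, Finset.sum_filter]
    refine Finset.sum_congr rfl fun s _ => ?_
    rw [freezeWeight]
    split_ifs with h
    · rw [hA.blockSum_frozenWith v h]
    · rfl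

lemma weight_eq_zero {p : Fin n} (hp : p ∉ pivots A) (t : ℕ) : weight v A y t p = 0 := by
  have h : ∀ s, ¬ PivotAt A p s := fun s hs => hp hs.mem_pivots
  simp [weight, firstWeight, freezeWeight, h]

lemma sum_weight_final (hA : IsRun A) :
    ∑ p, weight v A y n p = ∑ p ∈ pivots A, blockTotal v A p y := by
  rw [← Finset.sum_subset (Finset.subset_univ (pivots A)) fun p _ hp => weight_eq_zero v y hp n]
  exact Finset.sum_congr rfl fun p hp => weight_final v y hA hp

lemma sum_weight_sq_final (hA : IsRun A) : ∑ p, weight v A y n p ^ 2 = varProxy v A y := by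
  rw [varProxy_eq, ← Finset.sum_subset (Finset.subset_univ (pivots A)) fun p _ hp => by
    rw [weight_eq_zero v y hp n, zero_pow two_ne_zero]]
  exact Finset.sum_congr rfl fun p hp => by rw [weight_final v y hA hp]

lemma add_sum_weight_le {q : Fin n} {t : ℕ} {c : ℝ}
    (h : weight v A y t q + c ≤ weight v A y (t + 1) q) :
    ∑ p, weight v A y t p + c ≤ ∑ p, weight v A y (t + 1) p := by
  have := Finset.single_le_sum (f := fun p => weight v A y (t + 1) p - weight v A y t p)
    (fun p _ => sub_nonneg.2 (weight_le_succ v A y t p)) (Finset.mem_univ q)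
  rw [Finset.sum_sub_distrib] at this
  linarith

lemma add_sum_weight_sq_le {q : Fin n} {t : ℕ} {c : ℝ} (hc : 0 ≤ c)
    (h : weight v A y t q + c ≤ weight v A y (t + 1) q) :
    ∑ p, weight v A y t p ^ 2 + ((weight v A y t q + c) ^ 2 - weight v A y t q ^ 2) ≤
      ∑ p, weight v A y (t + 1) p ^ 2 := by
  have h1 := Finset.single_le_sum (f := fun p => weight v A y (t + 1) p ^ 2 - weight v A y t p ^ 2)
    (fun p _ => sub_nonneg.2 (pow_le_pow_left₀ (weight_nonneg v A y t p)
      (weight_le_succ v A y t p) 2)) (Finset.mem_univ q)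
  rw [Finset.sum_sub_distrib] at h1
  have h2 := pow_le_pow_left₀ (add_nonneg (weight_nonneg v A y t q) hc) h 2
  linarith

lemma sum_weight_sq_le_succ (t : ℕ) :
    ∑ p, weight v A y t p ^ 2 ≤ ∑ p, weight v A y (t + 1) p ^ 2 :=
  Finset.sum_le_sum fun p _ => pow_le_pow_left₀ (weight_nonneg v A y t p)
    (weight_le_succ v A y t p) 2

lemma weight_add_freeze_le {p : Fin n} {t : ℕ} (hp : PivotAt A p t) :
    weight v A y t p + |inner ℝ (pivotImage v (A (t + 1)) p - pivotImage v (A t) p) y| ≤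
      weight v A y (t + 1) p := by
  have h : freezeWeight v A y p t =
    |inner ℝ (pivotImage v (A (t + 1)) p - pivotImage v (A t) p) y| := if_pos hp
  rw [weight_succ, h]
  linarith [firstWeight_nonneg v A y p (t + 1)]

lemma weight_add_first_le {q : Fin n} {t : ℕ} (hq : PivotAt A q (t + 1))
    (hfirst : ∀ r < t + 1, ¬ PivotAt A q r) :
    weight v A y t q + |inner ℝ (pivotImage v (A (t + 1)) q) y| ≤ weight v A y (t + 1) q := by
  have h : firstWeight v A y q (t + 1) =
    |inner ℝ (pivotImage v (A (t + 1)) q) y| := if_pos ⟨hq, hfirst⟩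
  rw [weight_succ, h]
  linarith [freezeWeight_nonneg v A y q t]

/-- Either the phase continues, or the pivot was frozen and any next pivot is in its first step: an
earlier pivot that is still unfrozen would have been the pivot at t. -/
lemma IsRun.pivotAt_succ_or (hA : IsRun A) {p : Fin n} {t : ℕ} (hp : PivotAt A p t) :
    PivotAt A p (t + 1) ∨ (p ∉ A (t + 1) ∧
      ∀ q, PivotAt A q (t + 1) → ∀ r < t + 1, ¬ PivotAt A q r) := by
  have hsub : A (t + 1) ⊆ A t := hA.anti (Nat.le_succ t)
  by_cases hmem : p ∈ A (t + 1)
  · exact Or.inl (PivotAt.of_mem hmem fun i hi => hp.le (hsub hi))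
  · refine Or.inr ⟨hmem, fun q hq r hr hqr => hmem ?_⟩
    rw [← hA.eq_of_pivotAt_of_mem hp hqr (Nat.le_of_lt_succ hr) (hsub hq.mem)]
    exact hq.mem

lemma IsRun.abs_inner_pivotImage_le_weight (hA : IsRun A) {p : Fin n} {t : ℕ}
    (hp : PivotAt A p t) : |inner ℝ (pivotImage v (A t) p) y| ≤ weight v A y t p := by
  induction t with
  | zero =>
    have h : firstWeight v A y p 0 = |inner ℝ (pivotImage v (A 0) p) y| :=
      if_pos ⟨hp, fun r hr => absurd hr (Nat.not_lt_zero r)⟩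
    simp [weight, h]
  | succ t ih =>
    obtain ⟨q, hq⟩ : ∃ q, PivotAt A q t := exists_pivotAt ⟨p, hA.anti (Nat.le_succ t) hp.mem⟩
    rcases hA.pivotAt_succ_or hq with h | ⟨-, h⟩
    · obtain rfl := h.unique hp
      refine le_trans ?_ (weight_add_freeze_le v y hq)
      refine le_trans ?_ (add_le_add_left (ih hq) _)
      rw [inner_sub_left]
      calc _ = |inner ℝ (pivotImage v (A t) q) y + (inner ℝ (pivotImage v (A (t + 1)) q) y -
            inner ℝ (pivotImage v (A t) q) y)| := by congr 1; ring
        _ ≤ _ := abs_add_le _ _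
    · exact (le_add_of_nonneg_left (weight_nonneg v A y t p)).trans
        (weight_add_first_le v y hp (h p hp))

end Weights

variable {v : Fin n → EuclideanSpace ℝ (Fin d)} {u : (Fin n → ℝ) → Fin n → ℝ}

lemma combo_add_smul (v : Fin n → EuclideanSpace ℝ (Fin d)) (x y : Fin n → ℝ) (δ : ℝ) :
    combo v (x + δ • y) = combo v x + δ • combo v y := by
  simp only [combo, Pi.add_apply, Pi.smul_apply, smul_eq_mul, add_smul, mul_smul,
    Finset.sum_add_distrib, Finset.smul_sum]

lemma position_succ_of_eq_empty {ω : Fin n → Bool} {t : ℕ} (h : active u ω t = ∅) :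
    position u ω (t + 1) = position u ω t := by
  rw [position]
  split_ifs with ht
  · exact next_of_eq_empty h _
  · rfl

/-- The step of the walk after time `t`. -/
noncomputable def stepAt (u : (Fin n → ℝ) → Fin n → ℝ) (ω : Fin n → Bool) (t : Fin n) : ℝ :=
  signedStep (position u ω t) (u (position u ω t)) (ω t)

lemma IsDirectionRule.position_succ (hu : IsDirectionRule v u) {ω : Fin n → Bool} (t : Fin n)
    {p : Fin n} (hp : PivotAt (active u ω) p t) :
    combo v (position u ω (t + 1)) =
      combo v (position u ω t) + stepAt u ω t • pivotImage v (active u ω t) p ∧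
    position u ω (t + 1) p = position u ω t p + stepAt u ω t := by
  have h : position u ω (t + 1) =
      position u ω t + stepAt u ω t • u (position u ω t) := by
    rw [position, dif_pos t.2, next_eq ⟨p, hp.mem⟩]
    rfl
  rw [h, combo_add_smul, hu.combo_eq_pivotImage hp]
  refine ⟨rfl, ?_⟩
  rw [Pi.add_apply, Pi.smul_apply, hu.apply_pivot hp, smul_eq_mul, mul_one]

/-- Along every run `⟨∑ v_i X_i, y⟩` is at most twice the total weight. -/
lemma IsDirectionRule.abs_inner_combo_le (hu : IsDirectionRule v u) (ω : Fin n → Bool)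
    (y : EuclideanSpace ℝ (Fin d)) :
    |inner ℝ (combo v (position u ω n)) y| ≤
      2 * ∑ p ∈ pivots (active u ω), blockTotal v (active u ω) p y := by
  have hA := hu.isRun_active ω
  rw [← sum_weight_final v y hA]
  set A := active u ω with hAdef
  have hjump : ∀ (t : ℕ) (q : Fin n) (ξ c : ℝ), |ξ| ≤ 1 →
      |c * (ξ - position u ω t q)| ≤ 2 * |c| := by
    intro t q ξ c hξ
    rw [abs_mul, mul_comm]
    refine mul_le_mul_of_nonneg_right ?_ (abs_nonneg c)
    linarith [abs_sub ξ (position u ω t q), hu.abs_position_le ω t q]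
  -- Within a phase the walk is affine in the pivot coordinate as long as `pivotImage` is unchanged,
  -- so the induction bounds the extrapolation to every pivot value ξ ∈ [-1, 1]; the next position
  -- is the case ξ = X_{t+1}(p). Changing the slope by c costs |c(ξ - x)| ≤ 2|c|.
  have key : ∀ t ≤ n,
      (∀ p, PivotAt A p t → ∀ ξ : ℝ, |ξ| ≤ 1 → |inner ℝ (combo v (position u ω t)) y +
        inner ℝ (pivotImage v (A t) p) y * (ξ - position u ω t p)| ≤ 2 * ∑ p, weight v A y t p) ∧
      (A t = ∅ → |inner ℝ (combo v (position u ω t)) y| ≤ 2 * ∑ p, weight v A y t p) := by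
    intro t
    induction t with
    | zero =>
      intro _
      have h0 : combo v (position u ω 0) = 0 := by simp [combo, position]
      rw [h0, inner_zero_left]
      constructor
      · intro p hp ξ hξ
        rw [zero_add]
        refine (hjump 0 p ξ _ hξ).trans (mul_le_mul_of_nonneg_left ?_ zero_le_two)
        exact (hA.abs_inner_pivotImage_le_weight v y hp).trans
          (Finset.single_le_sum (f := fun p => weight v A y 0 p)
            (fun p _ => weight_nonneg v A y 0 p) (Finset.mem_univ p))
      · intro _
        rw [abs_zero]
        exact mul_nonneg zero_le_two (Finset.sum_nonneg fun p _ => weight_nonneg v A y 0 p)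
    | succ t ih =>
      intro ht
      obtain ⟨ih1, ih2⟩ := ih (by omega)
      rcases (A t).eq_empty_or_nonempty with he | hne
      · have hpos := position_succ_of_eq_empty he
        have he' : A (t + 1) = ∅ := Finset.subset_empty.1 (he ▸ hA.anti (Nat.le_succ t))
        refine ⟨fun p hp => absurd hp.mem (by simp [he']), fun _ => ?_⟩
        rw [hpos]
        exact (ih2 he).trans (mul_le_mul_of_nonneg_left
          (Finset.sum_le_sum fun p _ => weight_le_succ v A y t p) zero_le_two)
      · obtain ⟨p, hp⟩ := exists_pivotAt hne
        obtain ⟨hc, hx⟩ := hu.position_succ (⟨t, ht⟩ : Fin n) hp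
        simp only at hc hx
        set δ := stepAt u ω ⟨t, ht⟩
        have hinner : inner ℝ (combo v (position u ω (t + 1))) y =
            inner ℝ (combo v (position u ω t)) y + δ * inner ℝ (pivotImage v (A t) p) y := by
          rw [hc, inner_add_left, real_inner_smul_left]
        have hend : |inner ℝ (combo v (position u ω (t + 1))) y| ≤ 2 * ∑ p, weight v A y t p := by
          have := ih1 p hp _ (hu.abs_position_le ω (t + 1) p)
          rw [hinner]
          convert this using 2
          rw [hx]
          ring
        refine ⟨fun q hq ξ hξ => ?_, fun _ => hend.trans (mul_le_mul_of_nonneg_left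
          (Finset.sum_le_sum fun p _ => weight_le_succ v A y t p) zero_le_two)⟩
        rcases hA.pivotAt_succ_or hp with h | ⟨-, h⟩
        · obtain rfl := h.unique hq
          have h1 := add_sum_weight_le v y (weight_add_freeze_le v y hp)
          have h2 := ih1 p hp ξ hξ
          have h3 := hjump (t + 1) p ξ
            (inner ℝ (pivotImage v (A (t + 1)) p - pivotImage v (A t) p) y) hξ
          have h4 : inner ℝ (combo v (position u ω (t + 1))) y +
              inner ℝ (pivotImage v (A (t + 1)) p) y * (ξ - position u ω (t + 1) p) =
              (inner ℝ (combo v (position u ω t)) y +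
                inner ℝ (pivotImage v (A t) p) y * (ξ - position u ω t p)) +
              inner ℝ (pivotImage v (A (t + 1)) p - pivotImage v (A t) p) y *
                (ξ - position u ω (t + 1) p) := by
            rw [hinner, hx, inner_sub_left]
            ring
          rw [h4]
          linarith [abs_add_le (inner ℝ (combo v (position u ω t)) y +
                inner ℝ (pivotImage v (A t) p) y * (ξ - position u ω t p))
              (inner ℝ (pivotImage v (A (t + 1)) p - pivotImage v (A t) p) y *
                (ξ - position u ω (t + 1) p))]
        · have h1 := add_sum_weight_le v y (weight_add_first_le v y hq (h q hq))
          have h3 := hjump (t + 1) q ξ (inner ℝ (pivotImage v (A (t + 1)) q) y) hξ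
          linarith [abs_add_le (inner ℝ (combo v (position u ω (t + 1))) y)
            (inner ℝ (pivotImage v (A (t + 1)) q) y * (ξ - position u ω (t + 1) q))]
  exact (key n le_rfl).2 hA.final

/-- The conditional moment generating function of the remaining phase of the current pivot. -/
noncomputable def pivotMgf (v : Fin n → EuclideanSpace ℝ (Fin d)) (x : Fin n → ℝ)
    (y : EuclideanSpace ℝ (Fin d)) : ℝ :=
  if h : (unfrozen x).Nonempty then
    signMgf (x ((unfrozen x).max' h)) (inner ℝ (pivotImage v (unfrozen x) ((unfrozen x).max' h)) y)
  else 1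

lemma pivotMgf_of_max_eq {x : Fin n → ℝ} {p : Fin n} (hp : (unfrozen x).max = p)
    (y : EuclideanSpace ℝ (Fin d)) :
    pivotMgf v x y = signMgf (x p) (inner ℝ (pivotImage v (unfrozen x) p) y) := by
  have h : (unfrozen x).Nonempty := ⟨p, Finset.mem_of_max hp⟩
  have hmax : (unfrozen x).max' h = p := by
    have := (Finset.coe_max' h).trans hp
    exact_mod_cast this
  rw [pivotMgf, dif_pos h, hmax]

lemma pivotMgf_of_eq_empty {x : Fin n → ℝ} (h : unfrozen x = ∅) (y : EuclideanSpace ℝ (Fin d)) :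
    pivotMgf v x y = 1 := by
  rw [pivotMgf, dif_neg (by simp [h])]

/-- The exponential supermartingale of the walk in direction `y`. -/
noncomputable def potential (v : Fin n → EuclideanSpace ℝ (Fin d))
    (u : (Fin n → ℝ) → Fin n → ℝ) (y : EuclideanSpace ℝ (Fin d)) (t : ℕ) (ω : Fin n → Bool) : ℝ :=
  exp (inner ℝ (combo v (position u ω t)) y - (∑ p, weight v (active u ω) y t p ^ 2) / 2) *
    pivotMgf v (position u ω t) y

lemma IsDirectionRule.potential_succ_le (hu : IsDirectionRule v u) (y : EuclideanSpace ℝ (Fin d))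
    {ω : Fin n → Bool} (t : Fin n) {p : Fin n} (hp : PivotAt (active u ω) p t) :
    potential v u y (t + 1) ω ≤
      exp (inner ℝ (combo v (position u ω t)) y - (∑ p, weight v (active u ω) y t p ^ 2) / 2) *
        (exp (stepAt u ω t * inner ℝ (pivotImage v (active u ω t) p) y) *
          signMgf (position u ω t p + stepAt u ω t)
            (inner ℝ (pivotImage v (active u ω t) p) y)) := by
  have hA := hu.isRun_active ω
  obtain ⟨hc, hx⟩ := hu.position_succ t hp
  have hxle := hu.abs_position_le ω (t + 1)
  rw [potential, hc, ← hx, inner_add_left, real_inner_smul_left, ← mul_assoc, ← exp_add]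
  set A := active u ω with hAdef
  set δ := stepAt u ω t
  set C := inner ℝ (pivotImage v (A t) p) y with hC
  set B := inner ℝ (combo v (position u ω t)) y
  rcases hA.pivotAt_succ_or hp with h | ⟨hmem, h⟩
  · have h1 := add_sum_weight_sq_le v y (abs_nonneg _) (weight_add_freeze_le v y hp)
    set c := inner ℝ (pivotImage v (A (t + 1)) p - pivotImage v (A t) p) y with hcdef
    have hCc : inner ℝ (pivotImage v (A (t + 1)) p) y = C + c := by
      rw [hcdef, inner_sub_left]; ring
    have h2 : pivotMgf v (position u ω (t + 1)) y ≤ signMgf (position u ω (t + 1) p) C *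
        exp (((weight v A y t p + |c|) ^ 2 - weight v A y t p ^ 2) / 2) := by
      rw [pivotMgf_of_max_eq h]
      have : inner ℝ (pivotImage v (unfrozen (position u ω (t + 1))) p) y = C + c := hCc
      rw [this]
      exact signMgf_add_le (hxle p) (hA.abs_inner_pivotImage_le_weight v y hp)
    refine (mul_le_mul_of_nonneg_left h2 (exp_pos _).le).trans ?_
    rw [mul_comm (signMgf _ _), ← mul_assoc, ← exp_add]
    refine mul_le_mul_of_nonneg_right (exp_le_exp.2 ?_)
      (mul_nonneg (exp_pos _).le (cosh_add_mul_sinh_nonneg (hxle p) _))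
    linarith
  -- The phase of p is over and its factor is 1. A new pivot q costs at most exp(c²/2), which is
  -- covered because its weight grows by at least |c|.
  · have hp1 : |position u ω (t + 1) p| = 1 := abs_eq_one_of_notMem_unfrozen hxle hmem
    rw [signMgf_of_abs_eq_one hp1, mul_one]
    rcases (A (t + 1)).eq_empty_or_nonempty with he | hne
    · rw [pivotMgf_of_eq_empty he, mul_one, exp_le_exp]
      linarith [sum_weight_sq_le_succ v y (A := A) t]
    · obtain ⟨q, hq⟩ := exists_pivotAt hne
      have h1 := add_sum_weight_sq_le v y (abs_nonneg _) (weight_add_first_le v y hq (h q hq))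
      rw [pivotMgf_of_max_eq hq]
      refine (mul_le_mul_of_nonneg_left (signMgf_le (hxle q) _) (exp_pos _).le).trans ?_
      rw [← exp_add, exp_le_exp]
      have h2 : unfrozen (position u ω (t + 1)) = A (t + 1) := rfl
      rw [h2]
      set c := inner ℝ (pivotImage v (A (t + 1)) q) y
      have h3 := mul_nonneg (weight_nonneg v A y t q) (abs_nonneg c)
      have h4 := sq_abs c
      nlinarith

lemma IsDirectionRule.potential_step (hu : IsDirectionRule v u) (y : EuclideanSpace ℝ (Fin d))
    (t : Fin n) (ω : Fin n → Bool) :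
    coinProb u (position u ω t) true * potential v u y (t + 1) (Function.update ω t true) +
      coinProb u (position u ω t) false * potential v u y (t + 1) (Function.update ω t false) ≤
      potential v u y t ω := by
  have hx := hu.abs_position_le ω t
  have hpos : ∀ b, ∀ s ≤ (t : ℕ), position u (Function.update ω t b) s = position u ω s :=
    fun b s hs => position_update ω t b hs
  have hact : ∀ b, ∀ s ≤ (t : ℕ), active u (Function.update ω t b) s = active u ω s :=
    fun b s hs => congrArg unfrozen (hpos b s hs)
  have hwt : ∀ b p, weight v (active u (Function.update ω t b)) y t p =
      weight v (active u ω) y t p := fun b p => weight_congr v y (hact b) p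
  rcases (active u ω t).eq_empty_or_nonempty with he | hne
  · have h1 : ∀ b, potential v u y (t + 1) (Function.update ω t b) ≤ potential v u y t ω := by
      intro b
      have he' : active u (Function.update ω t b) t = ∅ := by rw [hact b t le_rfl, he]
      have hw := sum_weight_sq_le_succ v y (A := active u (Function.update ω t b)) t
      simp only [hwt] at hw
      rw [potential, potential, position_succ_of_eq_empty he', hpos b t le_rfl,
        pivotMgf_of_eq_empty he, mul_one, mul_one, exp_le_exp]
      linarith
    have h2 := hu.coinProb_add hx
    calc _ ≤ coinProb u (position u ω t) true * potential v u y t ω +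
          coinProb u (position u ω t) false * potential v u y t ω :=
          add_le_add (mul_le_mul_of_nonneg_left (h1 true) (coinProb_nonneg _))
            (mul_le_mul_of_nonneg_left (h1 false) (coinProb_nonneg _))
      _ = _ := by rw [← add_mul, h2, one_mul]
  · obtain ⟨p, hp⟩ := exists_pivotAt hne
    -- With δ the signed step, exp(δC) `signMgf` (x + δ) C = exp(-Cx)(cosh C + (x + δ) sinh C) is
    -- affine in δ. As δ has mean zero, averaging over the coin returns the current potential
    -- exactly.
    have hle : ∀ b, potential v u y (t + 1) (Function.update ω t b) ≤
        exp (inner ℝ (combo v (position u ω t)) y -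
          (∑ p, weight v (active u ω) y t p ^ 2) / 2) *
        (exp (-(inner ℝ (pivotImage v (active u ω t) p) y * position u ω t p)) *
          (cosh (inner ℝ (pivotImage v (active u ω t) p) y) +
            (position u ω t p + signedStep (position u ω t) (u (position u ω t)) b) *
              sinh (inner ℝ (pivotImage v (active u ω t) p) y))) := by
      intro b
      have hp' : PivotAt (active u (Function.update ω t b)) p t := by
        rw [PivotAt, hact b t le_rfl]; exact hp
      have h := hu.potential_succ_le y t hp'
      have hstep : stepAt u (Function.update ω t b) t =
          signedStep (position u ω t) (u (position u ω t)) b := by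
        rw [stepAt, hpos b t le_rfl, Function.update_self]
      simp only [hwt, hpos b t le_rfl, hact b t le_rfl, hstep] at h
      refine h.trans (le_of_eq ?_)
      set C := inner ℝ (pivotImage v (active u ω t) p) y
      set δ := signedStep (position u ω t) (u (position u ω t)) b
      have hexp : exp (-(C * position u ω t p)) =
          exp (δ * C) * exp (-(C * (position u ω t p + δ))) := by
        rw [← exp_add]; congr 1; ring
      rw [signMgf, hexp]
      ring
    have h1 := hu.coinProb_add hx
    have h2 := hu.coinProb_mul_signedStep hx hne
    refine (add_le_add (mul_le_mul_of_nonneg_left (hle true) (coinProb_nonneg _))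
      (mul_le_mul_of_nonneg_left (hle false) (coinProb_nonneg _))).trans (le_of_eq ?_)
    rw [potential, pivotMgf_of_max_eq hp, signMgf]
    have h3 : unfrozen (position u ω t) = active u ω t := rfl
    rw [h3]
    set K := exp (inner ℝ (combo v (position u ω t)) y -
          (∑ p, weight v (active u ω) y t p ^ 2) / 2)
    set C := inner ℝ (pivotImage v (active u ω t) p) y
    linear_combination K * exp (-(C * position u ω t p)) *
      ((cosh C + position u ω t p * sinh C) * h1 + sinh C * h2)

/-- The walk is subgaussian with variance proxy `varProxy`. -/
lemma IsDirectionRule.expect_exp_le_one (hu : IsDirectionRule v u)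
    (y : EuclideanSpace ℝ (Fin d)) :
    expect u (fun ω => exp (inner ℝ (combo v (position u ω n)) y -
      varProxy v (active u ω) y / 2)) ≤ 1 := by
  have h := expect_le (potential v u y) 1 (fun ω => ?_) (hu.potential_step y)
  · convert h using 3 with ω
    rw [potential, sum_weight_sq_final v y (hu.isRun_active ω),
      pivotMgf_of_eq_empty (hu.isRun_active ω).final, mul_one]
  · have hA := hu.isRun_active ω
    have h0 : combo v (position u ω 0) = 0 := by simp [combo, position]
    rw [potential, h0, inner_zero_left, zero_sub]
    rcases (active u ω 0).eq_empty_or_nonempty with he | hne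
    · rw [pivotMgf_of_eq_empty he, mul_one, exp_le_one_iff, neg_nonpos]
      exact div_nonneg (Finset.sum_nonneg fun _ _ => sq_nonneg _) zero_le_two
    · obtain ⟨p, hp⟩ := exists_pivotAt hne
      rw [pivotMgf_of_max_eq hp]
      refine (mul_le_mul_of_nonneg_left (signMgf_le (hu.abs_position_le ω 0 p) _)
        (exp_pos _).le).trans ?_
      rw [← exp_add, exp_le_one_iff]
      have h1 : |inner ℝ (pivotImage v (unfrozen (position u ω 0)) p) y| ≤
          weight v (active u ω) y 0 p := hA.abs_inner_pivotImage_le_weight v y hp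
      have h2 := Finset.single_le_sum (f := fun p => weight v (active u ω) y 0 p ^ 2)
        (fun _ _ => sq_nonneg _) (Finset.mem_univ p)
      have h3 := pow_le_pow_left₀ (abs_nonneg _) h1 2
      rw [sq_abs] at h3
      linarith

end GSW

/-! ### From the subgaussian bound to the maximum norm -/

namespace GSW

open Real

variable {n d : ℕ}

section Expectation

variable {v : Fin n → EuclideanSpace ℝ (Fin d)} {u : (Fin n → ℝ) → Fin n → ℝ}

lemma expect_mono {f g : (Fin n → Bool) → ℝ} (h : ∀ ω, f ω ≤ g ω) : expect u f ≤ expect u g :=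
  Finset.sum_le_sum fun ω _ => mul_le_mul_of_nonneg_left (h ω) (prob_nonneg ω)

lemma expect_add (f g : (Fin n → Bool) → ℝ) :
    expect u (fun ω => f ω + g ω) = expect u f + expect u g := by
  simp only [expect, mul_add, Finset.sum_add_distrib]

lemma expect_const_mul (c : ℝ) (f : (Fin n → Bool) → ℝ) :
    expect u (fun ω => c * f ω) = c * expect u f := by
  simp only [expect, Finset.mul_sum, mul_left_comm]

lemma expect_finset_sum {ι : Type*} (s : Finset ι) (f : ι → (Fin n → Bool) → ℝ) :
    expect u (fun ω => ∑ i ∈ s, f i ω) = ∑ i ∈ s, expect u (f i) := by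
  simp only [expect, Finset.mul_sum]
  exact Finset.sum_comm

lemma IsDirectionRule.expect_const (hu : IsDirectionRule v u) (c : ℝ) :
    expect u (fun _ => c) = c := by
  rw [expect, ← Finset.sum_mul, hu.sum_prob, one_mul]

lemma IsDirectionRule.exists_le_expect (hu : IsDirectionRule v u) (f : (Fin n → Bool) → ℝ) :
    ∃ ω, f ω ≤ expect u f := by
  by_contra! h
  have hpos : ∃ ω, 0 < prob u ω := by
    by_contra! h0
    have := Finset.sum_nonpos fun ω (_ : ω ∈ Finset.univ) => h0 ω
    rw [hu.sum_prob] at this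
    linarith
  obtain ⟨ω₀, hω₀⟩ := hpos
  have h1 : ∑ ω, prob u ω * expect u f < ∑ ω, prob u ω * f ω :=
    Finset.sum_lt_sum (fun ω _ => mul_le_mul_of_nonneg_left (h ω).le (prob_nonneg ω))
      ⟨ω₀, Finset.mem_univ _, mul_lt_mul_of_pos_left (h ω₀) hω₀⟩
  rw [← Finset.sum_mul, hu.sum_prob, one_mul] at h1
  exact lt_irrefl _ h1

lemma IsDirectionRule.exp_expect_le (hu : IsDirectionRule v u) (f : (Fin n → Bool) → ℝ) :
    exp (expect u f) ≤ expect u fun ω => exp (f ω) := by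
  have := convexOn_exp.map_sum_le (t := Finset.univ) (w := prob u) (p := f)
    (fun ω _ => prob_nonneg ω) hu.sum_prob fun _ _ => Set.mem_univ _
  simpa only [smul_eq_mul, expect] using this

end Expectation

lemma varProxy_smul (v : Fin n → EuclideanSpace ℝ (Fin d)) (A : ℕ → Finset (Fin n)) (c : ℝ)
    (y : EuclideanSpace ℝ (Fin d)) : varProxy v A (c • y) = c ^ 2 * varProxy v A y := by
  have h : ∀ p, blockTotal v A p (c • y) = |c| * blockTotal v A p y := by
    intro p
    rw [blockTotal, blockTotal, Finset.mul_sum]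
    refine Finset.sum_congr rfl fun s _ => ?_
    rw [← abs_mul, blockSum, blockSum, Finset.mul_sum]
    congr 1
    refine Finset.sum_congr rfl fun j _ => ?_
    rw [real_inner_smul_right]
    ring
  simp only [varProxy_eq, h, mul_pow, sq_abs, Finset.mul_sum]

lemma inner_combo_single (v : Fin n → EuclideanSpace ℝ (Fin d)) (x : Fin n → ℝ) (i : Fin d) :
    inner ℝ (combo v x) (EuclideanSpace.single i (1 : ℝ)) = ∑ j, v j i * x j := by
  simp [combo, EuclideanSpace.inner_single_right, mul_comm]

section Discrepancy

variable {v : Fin n → EuclideanSpace ℝ (Fin d)} {u : (Fin n → ℝ) → Fin n → ℝ}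

lemma IsDirectionRule.expect_exp_single_le_one (hu : IsDirectionRule v u) (c : ℝ) (i : Fin d) :
    expect u (fun ω => exp (c * ∑ j, v j i * position u ω n j -
      c ^ 2 * varProxy v (active u ω) (EuclideanSpace.single i 1) / 2)) ≤ 1 := by
  have h := hu.expect_exp_le_one (c • EuclideanSpace.single i (1 : ℝ))
  simpa only [varProxy_smul, real_inner_smul_right, inner_combo_single] using h

lemma two_le_exp_sub_add_exp_sub {a b : ℝ} :
    2 - 2 * a ≤ exp (b - a) + exp (-b - a) := by
  linarith [add_one_le_exp (b - a), add_one_le_exp (-b - a)]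

/-- Every summand on the right is nonnegative by `two_le_exp_sub_add_exp_sub`, so the sum dominates
the summand of a coordinate attaining the norm; the leading 2 restores what was subtracted there. -/
lemma exp_norm_sub_le (B Z : Fin d → ℝ) {c : ℝ} (hc : 0 ≤ c) (hZ : ∀ i, 0 ≤ Z i) :
    exp (c * ‖B‖ - c ^ 2 * (⨆ i, Z i) / 2) ≤
      2 + ∑ i, (exp (c * B i - c ^ 2 * Z i / 2) + exp (-c * B i - (-c) ^ 2 * Z i / 2) +
        (-2 + c ^ 2 * Z i)) := by
  rcases isEmpty_or_nonempty (Fin d) with hd | hd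
  · have : B = 0 := Subsingleton.elim _ _
    simp [this]
  · obtain ⟨i, hi⟩ := Finite.exists_max fun i => |B i|
    have hnorm : ‖B‖ ≤ |B i| := (pi_norm_le_iff_of_nonneg (abs_nonneg _)).2 hi
    have hsup : Z i ≤ ⨆ i, Z i := le_ciSup (Set.finite_range Z).bddAbove i
    have hterm : ∀ j, 0 ≤ exp (c * B j - c ^ 2 * Z j / 2) + exp (-c * B j - (-c) ^ 2 * Z j / 2) +
        (-2 + c ^ 2 * Z j) := by
      intro j
      have := two_le_exp_sub_add_exp_sub (a := c ^ 2 * Z j / 2) (b := c * B j)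
      rw [neg_sq, neg_mul]
      linarith
    have h1 := Finset.single_le_sum (f := fun j => exp (c * B j - c ^ 2 * Z j / 2) +
      exp (-c * B j - (-c) ^ 2 * Z j / 2) + (-2 + c ^ 2 * Z j)) (fun j _ => hterm j)
      (Finset.mem_univ i)
    have h2 : exp (c * ‖B‖ - c ^ 2 * (⨆ i, Z i) / 2) ≤
        exp (c * B i - c ^ 2 * Z i / 2) + exp (-c * B i - (-c) ^ 2 * Z i / 2) := by
      have h3 : exp (c * ‖B‖ - c ^ 2 * (⨆ i, Z i) / 2) ≤ exp (c * |B i| - c ^ 2 * Z i / 2) := by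
        gcongr
      refine h3.trans ?_
      rw [neg_sq, neg_mul]
      rcases abs_choice (B i) with h | h
      · rw [h]
        exact le_add_of_nonneg_right (exp_pos _).le
      · rw [h, mul_neg]
        exact le_add_of_nonneg_left (exp_pos _).le
    have h4 : 0 ≤ c ^ 2 * Z i := mul_nonneg (sq_nonneg c) (hZ i)
    linarith

lemma IsDirectionRule.mul_expect_norm_le (hu : IsDirectionRule v u) (hv : ∀ i, ‖v i‖ ≤ 1)
    {c : ℝ} (hc : 0 ≤ c) :
    c * expect u (fun ω => ‖(fun i : Fin d => ∑ j, v j i * position u ω n j : Fin d → ℝ)‖) ≤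
      c ^ 2 * (expect u fun ω =>
        ⨆ i : Fin d, varProxy v (active u ω) (EuclideanSpace.single i 1)) / 2 +
      log (2 + c ^ 2 * expect u fun ω => (nontrivSteps v (active u ω) : ℝ)) := by
  set K : (Fin n → Bool) → ℝ := fun ω =>
    ‖(fun i : Fin d => ∑ j, v j i * position u ω n j : Fin d → ℝ)‖ with hK
  set Z : (Fin n → Bool) → Fin d → ℝ := fun ω i =>
    varProxy v (active u ω) (EuclideanSpace.single i 1) with hZ
  -- Jensen's inequality moves the expectation into the exponent, so that only E max Z and E T̂
  -- enter the final bound.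
  have h1 := hu.exp_expect_le fun ω => c * K ω + -(c ^ 2 / 2) * ⨆ i, Z ω i
  rw [expect_add, expect_const_mul, expect_const_mul] at h1
  have h2 : (expect u fun ω => exp (c * K ω + -(c ^ 2 / 2) * ⨆ i, Z ω i)) ≤
      expect u fun ω => 2 + ∑ i, (exp (c * (∑ j, v j i * position u ω n j) - c ^ 2 * Z ω i / 2) +
        exp (-c * (∑ j, v j i * position u ω n j) - (-c) ^ 2 * Z ω i / 2) +
          (-2 + c ^ 2 * Z ω i)) := by
    refine expect_mono fun ω => ?_
    refine le_trans (le_of_eq ?_) (exp_norm_sub_le (fun i => ∑ j, v j i * position u ω n j)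
      (Z ω) hc fun i => varProxy_nonneg _ _ _)
    congr 1
    ring
  have h3 : (expect u fun ω => 2 + ∑ i, (exp (c * (∑ j, v j i * position u ω n j) -
        c ^ 2 * Z ω i / 2) + exp (-c * (∑ j, v j i * position u ω n j) - (-c) ^ 2 * Z ω i / 2) +
          (-2 + c ^ 2 * Z ω i))) ≤ 2 + ∑ i : Fin d, (c ^ 2 * expect u fun ω => Z ω i) := by
    rw [expect_add, hu.expect_const, expect_finset_sum]
    refine add_le_add_right (Finset.sum_le_sum fun i _ => ?_) _
    rw [expect_add, expect_add, expect_add, hu.expect_const, expect_const_mul]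
    have h4 := hu.expect_exp_single_le_one c i
    have h5 := hu.expect_exp_single_le_one (-c) i
    linarith
  have h4 : ∑ i : Fin d, (c ^ 2 * expect u fun ω => Z ω i) ≤
      c ^ 2 * expect u fun ω => (nontrivSteps v (active u ω) : ℝ) := by
    rw [← Finset.mul_sum, ← expect_finset_sum]
    exact mul_le_mul_of_nonneg_left (expect_mono fun ω =>
      sum_varProxy_single_le hv (hu.isRun_active ω)) (sq_nonneg c)
  have h5 := h1.trans (h2.trans (h3.trans (add_le_add_right h4 2)))
  have h6 := log_le_log (exp_pos _) h5
  rw [log_exp] at h6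
  linarith

lemma le_two_mul_max_of_forall_le {m z τ : ℝ} (hz : 0 ≤ z) (hτ : 2 ≤ τ)
    (h : ∀ c, 0 ≤ c → c * m ≤ c ^ 2 * z / 2 + log (2 + c ^ 2 * τ)) :
    m ≤ 2 * max 1 (√(2 * z) * √(log τ)) := by
  have hτ0 : 0 < τ := by linarith
  have hL : 0 < log τ := log_pos (by linarith)
  -- From log τ ≤ τ/e; the constant 2.7 < e still satisfies 4/2.7² ≤ 0.55.
  have hLle : log τ ≤ τ / 2.7 := by
    have h1 := log_le_sub_one_of_pos (x := τ / exp 1) (by positivity)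
    rw [log_div hτ0.ne' (exp_pos 1).ne', log_exp] at h1
    have h2 : τ / exp 1 ≤ τ / 2.7 :=
      div_le_div_of_nonneg_left hτ0.le (by norm_num) (by linarith [exp_one_gt_d9])
    linarith
  set L := log τ with hLdef
  -- Here 2 + c²τ ≤ 2 + 0.55 τ³ ≤ τ³, because τ ≥ 2.
  have hlog : ∀ c, c ^ 2 ≤ 4 * L ^ 2 → log (2 + c ^ 2 * τ) ≤ 3 * L := by
    intro c hc
    have h3 : 3 * L = log (τ ^ 3) := by rw [log_pow]; norm_num [hLdef]
    rw [h3]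
    refine log_le_log (by positivity) ?_
    have h4 : L ^ 2 ≤ (τ / 2.7) ^ 2 := pow_le_pow_left₀ hL.le hLle 2
    have h5 : c ^ 2 ≤ 0.55 * τ ^ 2 := by
      refine hc.trans ?_
      rw [div_pow] at h4
      norm_num at h4 ⊢
      nlinarith [sq_nonneg τ]
    have h6 : (2 : ℝ) ^ 3 ≤ τ ^ 3 := pow_le_pow_left₀ (by norm_num) hτ 3
    nlinarith [mul_le_mul_of_nonneg_right h5 hτ0.le]
  -- The choice c = √(2L/z) makes c²z/2 = L and satisfies c ≤ 2L exactly when zL ≥ 1/2; otherwise c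
  -- = 2L is used and c²z/2 ≤ L. In both cases cm ≤ L + 3L.
  rcases le_or_gt (z * L) (1 / 2) with hzL | hzL
  · have h1 := h (2 * L) (by positivity)
    have h2 := hlog (2 * L) (by ring_nf; rfl)
    have h3 : (2 * L) ^ 2 * z / 2 ≤ L := by nlinarith
    have h4 : m ≤ 2 := by
      refine le_of_mul_le_mul_left ?_ (by positivity : 0 < 2 * L)
      linarith
    exact h4.trans (by linarith [le_max_left 1 (√(2 * z) * √L)])
  · have hz0 : 0 < z := by
      rcases hz.eq_or_lt with h0 | h0
      · rw [← h0] at hzL; norm_num at hzL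
      · exact h0
    set s := √(2 * z) * √L with hs
    have hspos : 0 < s := by positivity
    have hssq : s ^ 2 = 2 * z * L := by
      rw [hs, mul_pow, sq_sqrt (by positivity), sq_sqrt hL.le]
    have hcsq : (s / z) ^ 2 = 2 * L / z := by
      rw [div_pow, hssq]; field_simp
    have h1 := h (s / z) (by positivity)
    have h2 := hlog (s / z) (by
      rw [hcsq, div_le_iff₀ hz0]
      nlinarith)
    rw [hcsq] at h1 h2
    have h3 : 2 * L / z * z / 2 = L := by field_simp
    rw [h3] at h1
    have h4 : s / z * m ≤ s / z * (2 * s) := by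
      have : s / z * (2 * s) = 4 * L := by
        rw [div_mul_eq_mul_div, show s * (2 * s) = 2 * s ^ 2 by ring, hssq]
        field_simp
        norm_num
      linarith
    have h5 : m ≤ 2 * s := le_of_mul_le_mul_left h4 (by positivity)
    exact h5.trans (by linarith [le_max_right 1 s])

lemma IsDirectionRule.norm_le_two (hu : IsDirectionRule v u) (hv : ∀ i, ‖v i‖ ≤ 1)
    {ω : Fin n → Bool} (hω : nontrivSteps v (active u ω) ≤ 1) :
    ‖(fun i : Fin d => ∑ j, v j i * position u ω n j : Fin d → ℝ)‖ ≤ 2 := by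
  refine (pi_norm_le_iff_of_nonneg zero_le_two).2 fun i => ?_
  have hA := hu.isRun_active ω
  have h1 := hu.abs_inner_combo_le ω (EuclideanSpace.single i (1 : ℝ))
  rw [inner_combo_single] at h1
  have h2 := sq_sum_blockTotal_le v (active u ω) (EuclideanSpace.single i (1 : ℝ))
  have h3 := varProxy_le hv hA (EuclideanSpace.single i (1 : ℝ))
  have h4 : (nontrivSteps v (active u ω) : ℝ) ≤ 1 := by exact_mod_cast hω
  have h5 : ‖EuclideanSpace.single i (1 : ℝ)‖ = 1 := by simp
  rw [h5, one_pow] at h3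
  have h6 := mul_le_one₀ h4 (varProxy_nonneg v (active u ω) _) h3
  have h7 : (∑ p ∈ pivots (active u ω), blockTotal v (active u ω) p
      (EuclideanSpace.single i (1 : ℝ))) ≤ 1 :=
    (le_abs_self _).trans ((sq_le_one_iff_abs_le_one _).1 (h2.trans h6))
  rw [Real.norm_eq_abs]
  linarith

end Discrepancy

end GSW

theorem mainTheorem1 {n d : ℕ} (v : Fin n → EuclideanSpace ℝ (Fin d)) (hv : ∀ i, ‖v i‖ ≤ 1)
    (u : (Fin n → ℝ) → Fin n → ℝ) (hu : GSW.IsDirectionRule v u) :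
    (∀ (ω : Fin n → Bool) (i : Fin d),
      GSW.varProxy v (GSW.active u ω) (EuclideanSpace.single i 1) ∈ Set.Icc (0 : ℝ) 1) ∧
    (∀ ω : Fin n → Bool, GSW.nontrivSteps v (GSW.active u ω) ≤ min d n) ∧
    ∃ X : Fin n → ℝ, (∀ j, X j = 1 ∨ X j = -1) ∧
      ‖(fun i : Fin d => ∑ j, v j i * X j : Fin d → ℝ)‖ ≤
        2 * max 1
          (√(2 * GSW.expect u fun ω =>
              ⨆ i : Fin d, GSW.varProxy v (GSW.active u ω) (EuclideanSpace.single i 1)) *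
            √(Real.log (GSW.expect u fun ω => (GSW.nontrivSteps v (GSW.active u ω) : ℝ)))) := by
  refine ⟨fun ω i => ⟨GSW.varProxy_nonneg _ _ _, ?_⟩,
    fun ω => GSW.nontrivSteps_le v (hu.isRun_active ω), ?_⟩
  · simpa using GSW.varProxy_le hv (hu.isRun_active ω) (EuclideanSpace.single i (1 : ℝ))
  rcases lt_or_ge (GSW.expect u fun ω => (GSW.nontrivSteps v (GSW.active u ω) : ℝ)) 2 with hτ | hτ
  · obtain ⟨ω, hω⟩ := hu.exists_le_expect fun ω => (GSW.nontrivSteps v (GSW.active u ω) : ℝ)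
    -- T̂ is an integer, so a run with T̂ < 2 has at most one nontrivial block; the term 1 in the
    -- maximum then suffices.
    have hω' : (GSW.nontrivSteps v (GSW.active u ω) : ℝ) < (2 : ℕ) := by
      exact_mod_cast hω.trans_lt hτ
    refine ⟨GSW.position u ω n, hu.position_final ω, (hu.norm_le_two hv
      (Nat.le_of_lt_succ (Nat.cast_lt.1 hω'))).trans ?_⟩
    exact le_mul_of_one_le_right zero_le_two (le_max_left _ _)
  · obtain ⟨ω, hω⟩ := hu.exists_le_expect fun ω =>
      ‖(fun i : Fin d => ∑ j, v j i * GSW.position u ω n j : Fin d → ℝ)‖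
    refine ⟨GSW.position u ω n, hu.position_final ω, hω.trans
      (GSW.le_two_mul_max_of_forall_le ?_ hτ fun c hc => hu.mul_expect_norm_le hv hc)⟩
    exact Finset.sum_nonneg fun ω _ => mul_nonneg (GSW.prob_nonneg ω)
      (Real.iSup_nonneg fun i => GSW.varProxy_nonneg _ _ _)
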